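/- Fix an integer $\mu\ge 2$ (the minimum arity). A FiBA structure over a totally ordered set of timestamps and a monoid $(S,\otimes,1)$ is a B-tree of (timestamp, value) entries, all of whose leaves have the same depth, in search-tree order, in which a node of arity $a$ has $a-1$ entries and, unless it is a leaf, $a$ children; non-root nodes have arity between $\mu$ and $2\mu$, the root has arity between $2$ and $2\mu$ (the empty window is a root leaf without entries). There are fingers to the leftmost and the rightmost leaf, and each node stores a partial aggregate: nodes off the two spines store the product of their whole subtree in timestamp order (up aggregate); the root stores the product of everything below it and in it except its first and last child's subtrees; a left-spine (right-spine) node below the root stores the product of its values and of the subtrees of all its children but the first (last), multiplied on the right (left) by the aggregate stored at its parent if the parent is not the root. The window is the sequence of all entries; $n$ denotes its size. The operation $\mathrm{bulkEvict}(t)$ removes all entries with timestamp $\le t$; $m$ denotes their number. Its algorithm has three steps. (1) Search: from the finger closest to $t$, walk up the spine to the lowest spine node whose subtree straddles $t$, then down to a leaf or to an entry with timestamp $t$, recording on each level the node, its right neighbor on the same level (possibly not a sibling), and their least common ancestor. (2) Pass up: on each recorded level, from bottom to top, drop the entries $\le t$ and the children to their left; if the node's arity falls below $\mu$, move a batch of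 entries and children from the neighbor (through the separating entry in the common ancestor) when $\mu-\text{node arity}\le \text{neighbor arity}-\mu$, and otherwise merge the node and the separating entry into the neighbor; a node without a neighbor becomes the root (or its only child does). Above the recorded levels, continue the repair along the left spine as long as a node underflows. Up and inner aggregates are recomputed along the way. (3) Pass down: recompute the stored aggregates down the left spine, and down the right spine when needed. Running time counts elementary steps (timestamp comparisons, monoid operations, pointer steps, moves of single entries or children). The operation $\mathrm{bulkInsert}(B)$, for a bulk $B$ with strictly increasing timestamps, adds the entries of $B$ to the leaves (combining values at timestamps already present) and, from the leaves up, splits each overfull node into nodes of arity $\mu+1$ and one last node of arity between $\mu$ and $2\mu$; $\mathrm{query}$ does not change the structure. Theorem. There is a constant $C>0$ depending only on $\mu$ such that, for all timestamp orders and all monoids: (a) (worst case) on every FiBA structure of size $n$, every call $\mathrm{bulkEvict}(t)$ takes at most $C\,(1+\log(1+n))$ steps; in particular so does every $\mathrm{bulkEvict}$ in any sequence of $\mathrm{query}$, $\mathrm{bulkInsert}$ and $\mathrm{bulkEvict}$ operations that starts from the empty window; (b) (amortized) in every finite sequence of $\mathrm{query}$, $\mathrm{bulkInsert}$ and $\mathrm{bulkEvict}$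 operations that starts from the empty window, if the $\mathrm{bulkEvict}$ calls evict $m_1,\dots,m_k$ entries, then their total running time is at most $C\sum_{i=1}^{k}\bigl(1+\log(1+m_i)\bigr)$. -/

import Mathlib

universe u v

/-! ### Step counting -/

/-- A computation that returns `val` after `time` elementary steps.  An elementary step is one
comparison of timestamps, one application of the monoid operation, following one pointer, or
copying, moving or dropping one entry or one child of a node. -/
structure Timed (α : Type*) where
  val : α
  time : ℕ

namespace Timed

instance : Monad Timed where
  pure a := ⟨a, 0⟩
  bind x f := ⟨(f x.val).val, x.time + (f x.val).time⟩

/-- Spend `k` elementary steps. -/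
def tick (k : ℕ) : Timed PUnit := ⟨PUnit.unit, k⟩

end Timed

namespace FiBA

open Timed (tick)

/-! ### The data structure -/

/-- A B-tree node: the stored partial aggregate, the list of entries (timestamp, value) and the
list of children.  Leaves have no children. -/
inductive Node (T : Type u) (S : Type v) where
  | mk (agg : S) (entries : List (T × S)) (children : List (Node T S)) : Node T S

namespace Node

variable {T : Type u} {S : Type v}

def agg : Node T S → S
  | mk a _ _ => a

def entries : Node T S → List (T × S)
  | mk _ es _ => es

def children : Node T S → List (Node T S)
  | mk _ _ cs => cs

/-- A node of arity `a` has `a - 1` entries (and, unless it is a leaf, `a` children). -/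
def arity (x : Node T S) : ℕ := x.entries.length + 1

end Node

/-- `alternate [a₀, a₁, …] [b₀, b₁, …] = [a₀, b₀, a₁, b₁, …]`; when one list is exhausted, the
rest of the other one follows. -/
def alternate {α : Type*} : List α → List α → List α
  | [], bs => bs
  | a :: as, [] => a :: as
  | a :: as, b :: bs => a :: b :: alternate as bs

/-- The entries of a complete subtree, in order: `c₀, e₀, c₁, …, e_{a-2}, c_{a-1}`. -/
def Node.toList {T : Type u} {S : Type v} : Node T S → List (T × S)
  | .mk _ es cs => (alternate (cs.map fun c => c.toList) (es.map fun e => [e])).flatten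

variable {T : Type u} {S : Type v}

/-- `children.agg` and own values, alternating and starting with a child.  For a complete node
this is the up aggregate `Π↑(c₀) v₀ … v_{a-2} Π↑(c_{a-1})`; for a node stored without its last child
it is `Π↑(c₀) v₀ … Π↑(c_{a-2}) v_{a-2}`. -/
def childFirst [Monoid S] (es : List (T × S)) (cs : List (Node T S)) : S :=
  (alternate (cs.map Node.agg) (es.map Prod.snd)).prod

/-- The same, starting with a value.  For a node stored without its first and last child this is
the inner aggregate `v₀ Π↑(c₁) … Π↑(c_{a-2}) v_{a-2}`; for a node stored without its first child only it
is `v₀ Π↑(c₁) … v_{a-2} Π↑(c_{a-1})`. -/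
def entryFirst [Monoid S] (es : List (T × S)) (cs : List (Node T S)) : S :=
  (alternate (es.map Prod.snd) (cs.map Node.agg)).prod

/-- Aggregate of the parent of a spine node, to be combined with its own; `above` lists the
proper ancestors other than the root, nearest first.  It is `1` if the parent is the root. -/
def parentAgg [Monoid S] : List (Node T S) → S
  | [] => 1
  | p :: _ => p.agg

end FiBA

/-- The finger B-tree, unrolled along its two spines so that the fingers give constant-time
access.  `left` is the left spine without the root, listed from the left finger (the leftmost leaf)
upwards, so that the next list cell is reached by the parent pointer; `right` is the right spine
without the root, listed from the right finger upwards.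

A spine node occurs in its parent's pointer list as the first (last) child; here that pointer is
represented by the adjacency in `left` (`right`).  So nodes of `left` are stored without
their first child, nodes of `right` without their last child, and the root without both.  The
position in this record also takes the place of the two Boolean spine flags.
A tree of height zero is a single leaf, the root; the empty window is a root leaf without
entries. -/
structure FiBA (T : Type u) (S : Type v) where
  left : List (FiBA.Node T S)
  root : FiBA.Node T S
  right : List (FiBA.Node T S)

namespace FiBA

open Timed (tick)

variable {T : Type u} {S : Type v}

/-- Put `c` back as the first child of `p`. -/
def attachFirst (p c : Node T S) : Node T S := .mk p.agg p.entries (c :: p.children)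

/-- Put `c` back as the last child of `p`. -/
def attachLast (p c : Node T S) : Node T S := .mk p.agg p.entries (p.children ++ [c])

/-- The complete subtree below the root that contains the left finger (if any). -/
def leftSubtree : List (Node T S) → Option (Node T S)
  | [] => none
  | x :: xs => some (xs.foldl (fun c p => attachFirst p c) x)

/-- The complete subtree below the root that contains the right finger (if any). -/
def rightSubtree : List (Node T S) → Option (Node T S)
  | [] => none
  | x :: xs => some (xs.foldl (fun c p => attachLast p c) x)

/-- The underlying B-tree, every node with all of its children. -/
def toTree (f : FiBA T S) : Node T S :=
  .mk f.root.agg f.root.entries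
    ((leftSubtree f.left).toList ++ f.root.children ++ (rightSubtree f.right).toList)

/-- The window contents, in order. -/
def window (f : FiBA T S) : List (T × S) := f.toTree.toList

/-- The empty window. -/
def empty [Monoid S] : FiBA T S := ⟨[], .mk 1 [] [], []⟩

/-! ### Invariants -/

/-- Height invariant and arity invariant for everything below a node of height `h`:
all leaves are at the same depth, a non-leaf node has one child more than entries, and all proper
descendants have arity between `μ` (`MIN_ARITY`) and `2 * μ` (`MAX_ARITY`). -/
def Node.Balanced (μ : ℕ) : ℕ → Node T S → Prop
  | 0, x => x.children = []
  | h + 1, x => x.children.length = x.arity ∧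
      ∀ c ∈ x.children, μ ≤ c.arity ∧ c.arity ≤ 2 * μ ∧ Node.Balanced μ h c

/-- All nodes of a complete subtree store their up aggregate. -/
inductive Node.UpAgg [Monoid S] : Node T S → Prop
  | mk (es : List (T × S)) (cs : List (Node T S)) :
      (∀ c ∈ cs, Node.UpAgg c) → Node.UpAgg (.mk (childFirst es cs) es cs)

/-- Left aggregates along the left spine, up aggregates off it. -/
def LeftAgg [Monoid S] : List (Node T S) → Prop
  | [] => True
  | x :: xs => x.agg = entryFirst x.entries x.children * parentAgg xs ∧
      (∀ c ∈ x.children, c.UpAgg) ∧ LeftAgg xs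

/-- Right aggregates along the right spine, up aggregates off it. -/
def RightAgg [Monoid S] : List (Node T S) → Prop
  | [] => True
  | x :: xs => x.agg = parentAgg xs * childFirst x.entries x.children ∧
      (∀ c ∈ x.children, c.UpAgg) ∧ RightAgg xs

/-- The invariants on height, arity, order and aggregates for `MIN_ARITY = μ`. -/
structure Valid [LinearOrder T] [Monoid S] (μ : ℕ) (f : FiBA T S) : Prop where
  spines : f.left.length = f.right.length
  balanced : f.toTree.Balanced μ f.left.length
  /-- The root has arity at least 2, except that the empty window is a root leaf of arity 1. -/
  root_min : 2 ≤ f.root.arity ∨ f.left = []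
  root_max : f.root.arity ≤ 2 * μ
  /-- Timestamps increase in every node, and the entry `i` of a node lies between everything in
  child `i` and everything in child `i + 1`. -/
  order : f.window.Pairwise fun a b => a.1 < b.1
  root_agg : f.root.agg = entryFirst f.root.entries f.root.children
  inner_agg : ∀ c ∈ f.root.children, c.UpAgg
  left_agg : LeftAgg f.left
  right_agg : RightAgg f.right

/-! ### Bulk eviction, step 1: eviction boundary search -/

/-- `t` is before the first timestamp. -/
def beforeFirst [LinearOrder T] (t : T) (es : List (T × S)) : Prop := ∀ e ∈ es.head?, t < e.1

/-- `t` is after the last timestamp. -/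
def afterLast [LinearOrder T] (t : T) (es : List (T × S)) : Prop := ∀ e ∈ es.getLast?, e.1 < t

instance [LinearOrder T] (t : T) (es : List (T × S)) : Decidable (beforeFirst t es) := by
  unfold beforeFirst; infer_instance

instance [LinearOrder T] (t : T) (es : List (T × S)) : Decidable (afterLast t es) := by
  unfold afterLast; infer_instance

/-- Walk up the left spine from the complete subtree `x`, whose spine ancestors below the root are
listed in the last argument, to the lowest spine node whose subtree straddles `t`.
Returns that subtree with its remaining ancestors, or, if only the root straddles `t`, the
first child of the root and no ancestor list. -/
def climbLeft [LinearOrder T] (t : T) (root : Node T S) :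
    Node T S → List (Node T S) → Timed (Node T S × Option (List (Node T S)))
  | x, [] => do
      tick 2
      if beforeFirst t root.entries then pure (x, some []) else pure (x, none)
  | x, p :: ps => do
      tick 2
      if beforeFirst t p.entries then pure (x, some (p :: ps))
      else climbLeft t root (attachFirst p x) ps

/-- Walk up the right spine to the lowest spine node whose subtree straddles `t`, where `t`
is known to be after all entries of the root. -/
def climbRight [LinearOrder T] (t : T) : Node T S → List (Node T S) → Timed (Node T S)
  | x, [] => do
      tick 1
      pure x
  | x, p :: ps => do
      tick (2 + p.arity)
      if afterLast t p.entries then pure x else climbRight t (attachLast p x) ps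

/-- One triple (node, ancestor, neighbor) of the boundary.  The neighbor is the next node
to the right on the same level, absent if the node is on the right spine; the least common ancestor
is represented by its one entry between the node and the neighbor.  `cut` is the
number of entries of the node with timestamp at most `t`. -/
structure Frame (T : Type u) (S : Type v) where
  node : Node T S
  cut : ℕ
  neighbor : Option ((T × S) × Node T S)

/-- The number of entries with timestamp at most `t`. -/
def countLE [LinearOrder T] (t : T) (es : List (T × S)) : ℕ := es.countP fun e => e.1 ≤ t

/-- The neighbor of child `i` of node `x`: its right sibling, separated by entry `i` of `x`; or, for
the last child, the first child of the neighbor of `x`, separated by the same entry as `x` is. -/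
def childNeighbor (x : Node T S) (i : ℕ) (nb : Option ((T × S) × Node T S)) :
    Option ((T × S) × Node T S) :=
  match x.entries.drop i, x.children.drop (i + 1) with
  | e :: _, d :: _ => some (e, d)
  | _, _ => match nb with
    | some (s, .mk _ _ (d :: _)) => some (s, d)
    | _ => none

/-- Walk down from the node `x` to the eviction point: a leaf, or the node that has an entry at time
`t`.  Returns the boundary as its lowest triple and the list of the others from bottom to top;
`acc` holds the triples above `x`. -/
def descend [LinearOrder T] (t : T) (x : Node T S) (nb : Option ((T × S) × Node T S))
    (acc : List (Frame T S)) : Timed (Frame T S × List (Frame T S)) :=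
  do
    tick (3 + 2 * x.arity)
    let i := countLE t x.entries
    if ∃ e ∈ x.entries, e.1 = t then pure (⟨x, i, nb⟩, acc)
    else match h : x.children[i]? with
      | none => pure (⟨x, i, nb⟩, acc)
      | some c => descend t c (childNeighbor x i nb) (⟨x, i, nb⟩ :: acc)
termination_by sizeOf x
decreasing_by
  cases x with
  | mk a es cs =>
    have h1 := List.sizeOf_lt_of_mem (List.mem_of_getElem? h)
    simp only [Node.children, Node.mk.sizeOf_spec] at h1 ⊢
    omega

/-! ### Bulk eviction, step 2: pass up -/

/-- State of one level after local eviction and rebalancing. -/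
inductive Outcome (T : Type u) (S : Type v) where
  /-- Node and neighbor both survive; the entry between them, in their least common ancestor. -/
  | two (node : Node T S) (sep : T × S) (neighbor : Node T S)
  /-- The node is gone; the entry that separated it has been taken out of the ancestor. -/
  | one (neighbor : Node T S)
  /-- There is no neighbor: everything above is evicted and this node becomes the root. -/
  | root (node : Node T S)

/-- Recompute the up aggregate of a node from its values and its children's aggregates. -/
def recompute [Monoid S] (x : Node T S) : Timed (Node T S) := do
  tick (2 * x.arity)
  pure (.mk (childFirst x.entries x.children) x.entries x.children)

/-- Move `k ≥ 1` entries and children from the neighbor to the node through the separating entry. -/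
def moveBatch [Monoid S] (k : ℕ) (x : Node T S) (s : T × S) (y : Node T S) :
    Timed (Outcome T S) := do
  tick (2 * (x.arity + k))
  match y.entries.drop (k - 1) with
  | [] => pure (.two x s y)
  | s' :: ys =>
    let x' : Node T S := .mk x.agg (x.entries ++ s :: y.entries.take (k - 1))
      (x.children ++ y.children.take k)
    let y' ← recompute (.mk y.agg ys (y.children.drop k))
    pure (.two x' s' y')

/-- Merge the node into its neighbor, together with the separating entry. -/
def mergeNotSibling [Monoid S] (x : Node T S) (s : T × S) (y : Node T S) :
    Timed (Outcome T S) := do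
  tick (2 * x.arity)
  let y' ← recompute (.mk y.agg (x.entries ++ s :: y.entries) (x.children ++ y.children))
  pure (.one y')

/-- Restore the arity invariant of a node after eviction.  With a neighbor: move a batch if the
node's deficit is at most the neighbor's surplus, else merge.  Without: the node becomes the root,
or its single child does if it has only one. -/
def rebalance [Monoid S] (μ : ℕ) (x : Node T S) (nb : Option ((T × S) × Node T S)) :
    Timed (Outcome T S) := do
  tick 2
  match nb with
  | none =>
    match x.entries, x.children with
    | [], [c] => pure (.root c)
    | _, _ => pure (.root x)
  | some (s, y) =>
    if μ ≤ x.arity then do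
      let y' ← recompute y
      pure (.two x s y')
    else if μ - x.arity ≤ y.arity - μ then moveBatch (μ - x.arity) x s y
    else mergeNotSibling x s y

/-- Replace the first child. -/
def setFirst (y d : Node T S) : Node T S := .mk y.agg y.entries (d :: y.children.drop 1)

/-- Local eviction and rebalancing at the lowest level of the boundary. -/
def evictBottom [Monoid S] (μ : ℕ) (fr : Frame T S) : Timed (Outcome T S) := do
  tick (2 * fr.node.arity)
  rebalance μ (.mk fr.node.agg (fr.node.entries.drop fr.cut) (fr.node.children.drop fr.cut))
    fr.neighbor

/-- Local eviction and rebalancing at a higher level, given the outcome of the level below. -/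
def evictLevel [Monoid S] (μ : ℕ) (fr : Frame T S) (low : Outcome T S) :
    Timed (Outcome T S) := do
  tick (2 * fr.node.arity)
  match fr.node.entries.drop fr.cut, low with
  | _, .root x => pure (.root x)
  -- the child's neighbor was its right sibling, and this node is their common ancestor
  | _ :: es, .two c s d =>
    rebalance μ (.mk fr.node.agg (s :: es) (c :: d :: fr.node.children.drop (fr.cut + 2)))
      fr.neighbor
  | _ :: es, .one d =>
    rebalance μ (.mk fr.node.agg es (d :: fr.node.children.drop (fr.cut + 2))) fr.neighbor
  -- the child's neighbor was the first child of this node's neighbor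
  | [], .two c s d =>
    rebalance μ (.mk fr.node.agg [] [c]) (fr.neighbor.map fun p => (s, setFirst p.2 d))
  | [], .one d =>
    match fr.neighbor with
    | none => pure (.root d)
    | some p => do
      let y ← recompute (setFirst p.2 d)
      pure (.one y)

/-- The eviction loop up the boundary; it ends early when a node becomes the root. -/
def evictLoop [Monoid S] (μ : ℕ) : Outcome T S → List (Frame T S) → Timed (Outcome T S)
  | .root x, _ => pure (.root x)
  | o, [] => pure o
  | o, fr :: frs => do
      let o' ← evictLevel μ fr o
      evictLoop μ o' frs

/-- Steps 1 (downward part) and 2 (eviction loop) from the top of the boundary. -/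
def evictBelow [LinearOrder T] [Monoid S] (μ : ℕ) (t : T) (top : Node T S)
    (nb : Option ((T × S) × Node T S)) : Timed (Outcome T S) := do
  let b ← descend t top nb []
  let o ← evictBottom μ b.1
  evictLoop μ o b.2

/-! ### Bulk eviction, step 3: pass down -/

/-- Repair left aggregates down the left spine of the complete subtree `x`; `pa` is the aggregate of
its parent (`1` if that is the root).  The spine nodes are put in front of `acc`. -/
def passDownLeft [Monoid S] (pa : S) (x : Node T S) (acc : List (Node T S)) :
    Timed (List (Node T S)) :=
  do
    tick (1 + 2 * x.arity)
    match h : x.children with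
    | [] => pure (.mk (entryFirst x.entries [] * pa) x.entries [] :: acc)
    | c :: cs =>
      passDownLeft (entryFirst x.entries cs * pa) c
        (.mk (entryFirst x.entries cs * pa) x.entries cs :: acc)
termination_by sizeOf x
decreasing_by
  cases x with
  | mk a es ds =>
    simp only [Node.children] at h
    subst h
    simp
    omega

/-- Repair right aggregates down the right spine of the complete subtree `x`. -/
def passDownRight [Monoid S] (pa : S) (x : Node T S) (acc : List (Node T S)) :
    Timed (List (Node T S)) :=
  do
    tick (1 + 3 * x.arity)
    match h : x.children.getLast? with
    | none => pure (.mk (pa * childFirst x.entries []) x.entries [] :: acc)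
    | some c =>
      passDownRight (pa * childFirst x.entries x.children.dropLast) c
        (.mk (pa * childFirst x.entries x.children.dropLast) x.entries x.children.dropLast :: acc)
termination_by sizeOf x
decreasing_by
  cases x with
  | mk a es cs =>
    have h1 := List.sizeOf_lt_of_mem (List.mem_of_getLast? h)
    simp only [Node.children, Node.mk.sizeOf_spec] at h1 ⊢
    omega

/-- Make the complete tree `x` the whole structure: recompute the inner aggregate of the root and
pass down both spines. -/
def makeRoot [Monoid S] (x : Node T S) : Timed (FiBA T S) := do
  tick (1 + 3 * x.arity)
  match x.children with
  | [] => pure ⟨[], .mk (entryFirst x.entries []) x.entries [], []⟩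
  | c :: cs =>
    match cs.getLast? with
    | none => pure ⟨[], .mk (entryFirst x.entries []) x.entries [], []⟩
    | some d => do
      let l ← passDownLeft 1 c []
      let r ← passDownRight 1 d []
      pure ⟨l, .mk (entryFirst x.entries cs.dropLast) x.entries cs.dropLast, r⟩

/-! ### Bulk eviction: repair loop above the boundary, and the whole operation -/

/-- For an ancestor `p` on the left spine (or the root), stored without its first child: the second
child with the entry before it, i.e. the neighbor of the first child. -/
def firstNeighbor (p : Node T S) : Option ((T × S) × Node T S) :=
  match p.entries, p.children with
  | s :: _, y :: _ => some (s, y)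
  | _, _ => none

/-- Put the outcome for the first child into its parent `p`, completing `p`. -/
def plug (p : Node T S) : Outcome T S → Node T S
  | .two x s y => .mk p.agg (s :: p.entries.drop 1) (x :: y :: p.children.drop 1)
  | .one y => .mk p.agg (p.entries.drop 1) (y :: p.children.drop 1)
  | .root x => x

/-- Follow the pointer from the root to its last child; in the present layout this re-attaches the
right spine, which is paid for per level. -/
def completeRight (f : FiBA T S) : Timed (Node T S) := do
  tick (1 + (f.right.map Node.arity).sum + f.root.arity)
  match rightSubtree f.right with
  | none => pure f.root
  | some c => pure (attachLast f.root c)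

/-- The repair has reached the root `p` (complete except for its first child). -/
def repairRoot [Monoid S] (μ : ℕ) (p : Node T S) (o : Outcome T S) : Timed (FiBA T S) := do
  tick (2 * p.arity)
  match o with
  | .root x => makeRoot x
  | o => do
    match ← rebalance μ (plug p o) none with
    | .root x => makeRoot x
    | _ => makeRoot (plug p o)

/-- The repair loop: `o` is the outcome for the first child of the left-spine node `p`, whose own
ancestors below the root are `ps`.  It stops at the first ancestor that does not underflow, and
then passes down the left spine from there. -/
def repairLoop [Monoid S] (μ : ℕ) (f : FiBA T S) :
    Outcome T S → Node T S → List (Node T S) → Timed (FiBA T S)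
  | .root x, _, _ => makeRoot x
  | o, p, ps => do
      tick (2 + 2 * p.arity)
      if μ ≤ (plug p o).arity then do
        let l ← passDownLeft (parentAgg ps) (plug p o) ps
        pure { f with left := l }
      else match ps with
        | [] => do
          let r ← completeRight f
          let o' ← rebalance μ (plug p o) (firstNeighbor r)
          repairRoot μ r o'
        | q :: qs => do
          let o' ← rebalance μ (plug p o) (firstNeighbor q)
          repairLoop μ f o' q qs

/-- `bulkEvict(t)`: remove all entries with timestamp at most `t`.  The search starts from the
right finger if `t` is beyond the last entry of the root and from the left finger otherwise. -/
def bulkEvict [LinearOrder T] [Monoid S] (μ : ℕ) (f : FiBA T S) (t : T) : Timed (FiBA T S) := do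
  tick 3
  match f.left, f.right with
  | l :: ls, r :: rs =>
    if afterLast t f.root.entries then do
      let top ← climbRight t r rs
      let o ← evictBelow μ t top none
      repairRoot μ top o
    else do
      match ← climbLeft t f.root l ls with
      | (x, none) => do
        let p ← completeRight f
        let o ← evictBelow μ t (attachFirst p x) none
        repairRoot μ p o
      | (x, some []) => do
        let p ← completeRight f
        let o ← evictBelow μ t x (firstNeighbor p)
        repairRoot μ p o
      | (x, some (p :: ps)) => do
        let o ← evictBelow μ t x (firstNeighbor p)
        repairLoop μ f o p ps
  | _, _ => do
    let o ← evictBelow μ t f.root none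
    repairRoot μ f.root o

/-! ### Bulk insertion -/

/-- Interleave two lists in timestamp order; entries with equal timestamps are combined. -/
def interleave [LinearOrder T] [Monoid S] : List (T × S) → List (T × S) → List (T × S)
  | [], bs => bs
  | e :: es, [] => e :: es
  | e :: es, b :: bs =>
    if e.1 < b.1 then e :: interleave es (b :: bs)
    else if b.1 < e.1 then b :: interleave (e :: es) bs
    else (e.1, e.2 * b.2) :: interleave es bs

/-- `bulkSplit`: cut a node with entries `es` and children `cs` into nodes of arity `μ + 1` and a last
one of arity at most `2 * μ`.  Returns the promoted entries and the nodes they separate. -/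
def bulkSplit [Monoid S] (μ : ℕ) (es : List (T × S)) (cs : List (Node T S)) :
    List (T × S) × List (Node T S) :=
  if es.length + 1 ≤ 2 * μ then ([], [.mk 1 es cs])
  else match h : es.drop μ with
    | [] => ([], [.mk 1 es cs])
    | s :: rest =>
      let r := bulkSplit μ rest (cs.drop (μ + 1))
      (s :: r.1, .mk 1 (es.take μ) (cs.take (μ + 1)) :: r.2)
termination_by es.length
decreasing_by
  have h1 := congrArg List.length h
  simp only [List.length_drop, List.length_cons] at h1
  omega

mutual

/-- Insert the sorted bulk `B` below a node, from the leaves up, splitting overfull nodes. -/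
def insertNode [LinearOrder T] [Monoid S] (μ : ℕ) :
    Node T S → List (T × S) → List (T × S) × List (Node T S)
  | .mk _ es [], B => bulkSplit μ (interleave es B) []
  | .mk _ es (c :: cs), B =>
    let r := insertChildren μ (c :: cs) es B
    bulkSplit μ r.1 r.2

/-- Distribute the bulk over the children and entries of a node; returns the node's new
entries and children. -/
def insertChildren [LinearOrder T] [Monoid S] (μ : ℕ) :
    List (Node T S) → List (T × S) → List (T × S) → List (T × S) × List (Node T S)
  | [], es, _ => (es, [])
  | c :: _, [], B => insertNode μ c B
  | c :: cs, e :: es, B =>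
    let l := insertNode μ c (B.filter fun b => b.1 < e.1)
    let r := insertChildren μ cs es (B.filter fun b => e.1 < b.1)
    (l.1 ++ interleave [e] (B.filter fun b => b.1 = e.1) ++ r.1, l.2 ++ r.2)

end

/-- Grow the tree at the top until a single root is left. -/
def growRoot [Monoid S] (μ : ℕ) : ℕ → List (T × S) → List (Node T S) → Node T S
  | 0, es, cs => .mk 1 es cs
  | k + 1, es, cs => match cs with
    | [x] => x
    | cs => growRoot μ k (bulkSplit μ es cs).1 (bulkSplit μ es cs).2

/-- Store the up aggregate at every node of a complete tree. -/
def Node.upAll [Monoid S] : Node T S → Node T S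
  | .mk _ es cs => .mk (childFirst es (cs.map fun c => c.upAll)) es (cs.map fun c => c.upAll)

/-- The effect of `bulkInsert(B)` on the structure (only its result, not its running time). -/
def bulkInsert [LinearOrder T] [Monoid S] (μ : ℕ) (f : FiBA T S) (B : List (T × S)) : FiBA T S :=
  let r := insertNode μ f.toTree B
  (makeRoot (growRoot μ (r.1.length + 2) r.1 r.2).upAll).val

/-! ### Sequences of operations -/

/-- The operations of a sliding window. -/
inductive Op (T : Type u) (S : Type v) where
  | query
  | bulkInsert (B : List (T × S))
  | bulkEvict (t : T)

/-- A bulk to be inserted has strictly increasing timestamps. -/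
def Op.WellFormed [LinearOrder T] : Op T S → Prop
  | .bulkInsert B => B.Pairwise fun a b => a.1 < b.1
  | _ => True

/-- The number `n` of entries in the window. -/
def size (f : FiBA T S) : ℕ := f.window.length

/-- The number `m` of entries that `bulkEvict(t)` has to evict. -/
def evictCount [LinearOrder T] (f : FiBA T S) (t : T) : ℕ := f.window.countP fun e => e.1 ≤ t

/-- What is recorded about one bulk eviction: running time, `m`, and `n` before the eviction. -/
structure EvictRecord where
  time : ℕ
  m : ℕ
  n : ℕ

/-- Execute a sequence of operations and record all of its bulk evictions. -/
def evictions [LinearOrder T] [Monoid S] (μ : ℕ) : FiBA T S → List (Op T S) → List EvictRecord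
  | _, [] => []
  | f, .query :: ops => evictions μ f ops
  | f, .bulkInsert B :: ops => evictions μ (bulkInsert μ f B) ops
  | f, .bulkEvict t :: ops =>
    ⟨(bulkEvict μ f t).time, evictCount f t, size f⟩ :: evictions μ (bulkEvict μ f t).val ops

end FiBA

-- Projections of timed computations

namespace Timed

-- The proof uses a potential: $50\mu$ times the number of nodes of minimal arity ("tight" nodes) on
-- the left spine, the root excluded (`tightCount`). Running time depends on stored aggregates
-- nowhere, so the proof carries only the invariants on height and arity (`Shape`) together with
-- increasing timestamps. For the latter it suffices that an eviction leaves a sublist of the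
-- window; which entries survive need not be determined.
--
-- Part of an eviction is local. Let $k$ be the level charged for it. Climbing past a left-spine
-- node means that its first entry is at most $t$, so the whole subtree climbed from is evicted; a
-- subtree of height $h$ has at least $2^{h+1}-1$ entries, whence $2^k\le 2(m+1)$
-- (`climbLeft_spec`). If $t$ lies beyond the root's last entry, the whole left subtree goes and the
-- full height is $O(\log(1+m))$. The search and the eviction along the boundary cost $O(1)$ per
-- level (`evictFrom_spec`), and the new part of the left spine has at most $k+1$ tight nodes; both
-- are charged to $k+1$.
--
-- What remains is the repair above the boundary, which may climb much higher than $\log m$. The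
-- outcome of the level below removes at most one entry from the parent (`plug_spec`), so a parent
-- that underflows was tight. If a batch is moved, the next ancestor keeps its arity and the repair
-- stops. If the node is merged, the merged node has arity above $\mu$, and one tight node has
-- disappeared. The released $50\mu$ pays for the iteration and also for one more level of passing
-- down, since the pass starts at the level where the repair ends (`repairLoop_spec`).
--
-- Insertion never raises the potential: nodes gain entries, a split leaves a first piece of arity
-- $\mu+1$, and a root that joins the spine has just been split (`bulkInsert_spec`).
--
-- Summing over a sequence from the empty window, whose potential is $0$, gives the amortized bound.
-- For the worst case, the potential is at most $50\mu$ times the height, which is logarithmic in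
-- $n$.

@[simp] theorem val_pure {α : Type*} (a : α) : (pure a : Timed α).val = a := rfl

@[simp] theorem time_pure {α : Type*} (a : α) : (pure a : Timed α).time = 0 := rfl

@[simp] theorem val_bind {α β : Type u} (x : Timed α) (f : α → Timed β) :
    (x >>= f).val = (f x.val).val := rfl

@[simp] theorem time_bind {α β : Type u} (x : Timed α) (f : α → Timed β) :
    (x >>= f).time = x.time + (f x.val).time := rfl

@[simp] theorem time_tick (k : ℕ) : (tick k).time = k := rfl

end Timed

namespace FiBA

variable {T : Type u} {S : Type v}

-- Contents of nodes as alternating lists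

@[simp] theorem Node.agg_mk (a : S) (es : List (T × S)) (cs : List (Node T S)) :
    (Node.mk a es cs).agg = a := rfl

@[simp] theorem Node.entries_mk (a : S) (es : List (T × S)) (cs : List (Node T S)) :
    (Node.mk a es cs).entries = es := rfl

@[simp] theorem Node.children_mk (a : S) (es : List (T × S)) (cs : List (Node T S)) :
    (Node.mk a es cs).children = cs := rfl

@[simp] theorem Node.arity_mk (a : S) (es : List (T × S)) (cs : List (Node T S)) :
    (Node.mk a es cs).arity = es.length + 1 := rfl

/-- After one element the two lists exchange roles. This is what makes `weave` and `weaveE` unfold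
into each other and replaces every later recursion on `alternate`. -/
theorem alternate_cons {α : Type*} (a : α) (as bs : List α) :
    alternate (a :: as) bs = a :: alternate bs as := by
  match bs with
  | [] => simp [alternate]
  | b :: bs => rw [alternate, alternate_cons b bs as]
termination_by as.length + bs.length

/-- Contents of a node whose subtrees and entries alternate, starting with a subtree. -/
def weave (es : List (T × S)) (cs : List (Node T S)) : List (T × S) :=
  (alternate (cs.map Node.toList) (es.map fun e => [e])).flatten

/-- Contents of a node whose entries and subtrees alternate, starting with an entry. -/
def weaveE (es : List (T × S)) (cs : List (Node T S)) : List (T × S) :=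
  (alternate (es.map fun e => [e]) (cs.map Node.toList)).flatten

@[simp] theorem Node.toList_mk (a : S) (es : List (T × S)) (cs : List (Node T S)) :
    (Node.mk a es cs).toList = weave es cs := by
  rw [Node.toList, weave]

theorem Node.toList_eq (x : Node T S) : x.toList = weave x.entries x.children := by
  cases x; simp

@[simp] theorem weave_nil_right (es : List (T × S)) :
    weave es ([] : List (Node T S)) = es := by
  induction es with
  | nil => simp [weave, alternate]
  | cons e es ih => simpa [weave, alternate] using ih

@[simp] theorem weave_cons (es : List (T × S)) (c : Node T S) (cs : List (Node T S)) :
    weave es (c :: cs) = c.toList ++ weaveE es cs := by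
  simp [weave, weaveE, alternate_cons]

@[simp] theorem weaveE_cons (e : T × S) (es : List (T × S)) (cs : List (Node T S)) :
    weaveE (e :: es) cs = e :: weave es cs := by
  simp [weave, weaveE, alternate_cons]

@[simp] theorem weaveE_nil_nil : weaveE ([] : List (T × S)) ([] : List (Node T S)) = [] := by
  simp [weaveE, alternate]

@[simp] theorem weaveE_nil_right (es : List (T × S)) :
    weaveE es ([] : List (Node T S)) = es := by
  cases es <;> simp

/-- The length condition describes a node that lacks its last child, as on the right spine; without
it the new child would not land at the end. -/
theorem weave_concat {es : List (T × S)} {cs : List (Node T S)} (x : Node T S)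
    (h : cs.length = es.length) : weave es (cs ++ [x]) = weave es cs ++ x.toList := by
  induction cs generalizing es with
  | nil =>
    obtain rfl : es = [] := by simpa using h.symm
    simp
  | cons c cs ih =>
    cases es with
    | nil => simp at h
    | cons e es => simp [ih (es := es) (by simpa using h)]

theorem weaveE_concat {es : List (T × S)} {cs : List (Node T S)} (x : Node T S)
    (h : cs.length + 1 = es.length) : weaveE es (cs ++ [x]) = weaveE es cs ++ x.toList := by
  cases es with
  | nil => simp at h
  | cons e es => simp [weave_concat (es := es) x (by simpa using h)]

theorem weave_append {es₁ : List (T × S)} {cs₁ : List (Node T S)} (s : T × S)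
    (es₂ : List (T × S)) (cs₂ : List (Node T S)) (h : cs₁.length = es₁.length + 1) :
    weave (es₁ ++ s :: es₂) (cs₁ ++ cs₂) = weave es₁ cs₁ ++ s :: weave es₂ cs₂ := by
  induction es₁ generalizing cs₁ with
  | nil =>
    obtain ⟨c, rfl⟩ := List.length_eq_one_iff.1 (by simpa using h)
    simp
  | cons e es ih =>
    cases cs₁ with
    | nil => simp at h
    | cons c cs => simp [ih (cs₁ := cs) (by simpa using h)]

theorem entries_sublist_weaveE (es : List (T × S)) (cs : List (Node T S)) :
    es.Sublist (weaveE es cs) := by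
  induction es generalizing cs with
  | nil => simp
  | cons e es ih =>
    cases cs with
    | nil => simp
    | cons c cs =>
      simp only [weaveE_cons, weave_cons, List.cons_sublist_cons]
      exact (ih cs).trans (List.sublist_append_right _ _)

/-! ### Shape invariants -/

/-- A complete subtree of height `h` below the root. -/
def Good (μ h : ℕ) (c : Node T S) : Prop := μ ≤ c.arity ∧ c.arity ≤ 2 * μ ∧ c.Balanced μ h

theorem balanced_succ {μ h : ℕ} {x : Node T S} : x.Balanced μ (h + 1) ↔
    x.children.length = x.entries.length + 1 ∧ ∀ c ∈ x.children, Good μ h c := by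
  simp [Node.Balanced, Good, Node.arity]

theorem balanced_zero {μ : ℕ} {x : Node T S} : x.Balanced μ 0 ↔ x.children = [] := by
  simp [Node.Balanced]

theorem Balanced.congr {μ h : ℕ} {x y : Node T S} (hx : x.Balanced μ h)
    (he : y.entries.length = x.entries.length) (hc : y.children = x.children) :
    y.Balanced μ h := by
  cases h with
  | zero => rw [balanced_zero] at *; rw [hc, hx]
  | succ h => rw [balanced_succ] at *; rwa [hc, he]

/-- Height zero is separate because a leaf has no children, so the count "one child more than
entries" that aligns the two alternations holds only above it. -/
theorem Balanced.join {μ h : ℕ} {a b : S} {es₁ es₂ : List (T × S)} {cs₁ cs₂ : List (Node T S)}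
    (c : S) (s : T × S) (h₁ : (Node.mk a es₁ cs₁).Balanced μ h)
    (h₂ : (Node.mk b es₂ cs₂).Balanced μ h) :
    (Node.mk c (es₁ ++ s :: es₂) (cs₁ ++ cs₂)).Balanced μ h ∧
      weave (es₁ ++ s :: es₂) (cs₁ ++ cs₂) = weave es₁ cs₁ ++ s :: weave es₂ cs₂ := by
  cases h with
  | zero =>
    rw [balanced_zero] at *
    simp only [Node.children_mk] at *
    subst h₁ h₂
    simp
  | succ h =>
    rw [balanced_succ] at *
    simp only [Node.children_mk, Node.entries_mk] at *
    refine ⟨⟨by simp; omega, fun c hc => ?_⟩, weave_append s es₂ cs₂ h₁.1⟩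
    rcases List.mem_append.1 hc with hc | hc
    · exact h₁.2 c hc
    · exact h₂.2 c hc

/-- Cutting at an entry serves both local eviction (keep the right part) and a batch move (the left
part goes to the node, the cut entry becomes the separator). -/
theorem Balanced.split {μ h : ℕ} {a : S} {es : List (T × S)} {cs : List (Node T S)}
    (hx : (Node.mk a es cs).Balanced μ h) {j : ℕ} {s : T × S} {ys : List (T × S)}
    (hj : es.drop j = s :: ys) (b c : S) :
    (Node.mk b (es.take j) (cs.take (j + 1))).Balanced μ h ∧
      (Node.mk c ys (cs.drop (j + 1))).Balanced μ h ∧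
      weave es cs = weave (es.take j) (cs.take (j + 1)) ++ s :: weave ys (cs.drop (j + 1)) := by
  have hes : es = es.take j ++ s :: ys := by rw [← hj, List.take_append_drop]
  have hlen : es.length = j + 1 + ys.length := by
    have := congrArg List.length hj
    simp at this
    omega
  cases h with
  | zero =>
    rw [balanced_zero] at *
    simp only [Node.children_mk] at *
    subst hx
    simpa [balanced_zero] using hes
  | succ h =>
    rw [balanced_succ] at *
    simp only [Node.children_mk, Node.entries_mk] at hx
    refine ⟨⟨by simp; omega, fun c hc => hx.2 c (List.mem_of_mem_take hc)⟩, ?_, ?_⟩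
    · rw [balanced_succ]
      exact ⟨by simp; omega, fun c hc => hx.2 c (List.mem_of_mem_drop hc)⟩
    · rw [← weave_append s ys _ (by simp; omega), ← hes, List.take_append_drop]

theorem Balanced.drop {μ h : ℕ} {a : S} {es : List (T × S)} {cs : List (Node T S)}
    (hx : (Node.mk a es cs).Balanced μ h) {j : ℕ} (hj : j ≤ es.length) (b : S) :
    (Node.mk b (es.drop j) (cs.drop j)).Balanced μ h ∧
      (weave (es.drop j) (cs.drop j)).Sublist (weave es cs) := by
  cases j with
  | zero => exact ⟨Balanced.congr hx rfl rfl, by simp⟩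
  | succ j =>
    obtain ⟨_, h2, h3⟩ := Balanced.split hx (j := j) (List.drop_eq_getElem_cons (by omega)) b b
    exact ⟨h2, by rw [h3]; exact ((List.sublist_cons_self _ _).trans
      (List.sublist_append_right _ _))⟩

/-- A complete tree of height `h` that may stand at the root. -/
structure RootTree (μ h : ℕ) (x : Node T S) : Prop where
  balanced : x.Balanced μ h
  arity_le : x.arity ≤ 2 * μ
  two_le : 2 ≤ x.arity ∨ h = 0

/-- A node of height `h` that is stored without its first or its last child. -/
def Half (μ : ℕ) : ℕ → Node T S → Prop
  | 0, x => x.children = []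
  | h + 1, x => x.children.length = x.entries.length ∧ ∀ c ∈ x.children, Good μ h c

/-- A part of a spine, listed upwards from height `k`. -/
def Spine (μ : ℕ) : ℕ → List (Node T S) → Prop
  | _, [] => True
  | k, p :: ps => (μ ≤ p.arity ∧ p.arity ≤ 2 * μ) ∧ Half μ k p ∧ Spine μ (k + 1) ps

/-- `1` if the node has minimal arity, `0` otherwise. -/
def tight (μ : ℕ) (x : Node T S) : ℕ := if x.arity = μ then 1 else 0

theorem tight_le_one (μ : ℕ) (x : Node T S) : tight μ x ≤ 1 := by
  unfold tight; split_ifs <;> omega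

/-- The number of nodes of minimal arity. -/
def tightCount (μ : ℕ) (ps : List (Node T S)) : ℕ := ps.countP fun p => p.arity = μ

@[simp] theorem tightCount_nil (μ : ℕ) : tightCount μ ([] : List (Node T S)) = 0 := rfl

theorem tightCount_cons (μ : ℕ) (p : Node T S) (ps : List (Node T S)) :
    tightCount μ (p :: ps) = tight μ p + tightCount μ ps := by
  simp [tightCount, tight, List.countP_cons, add_comm]

/-- The number of nodes of minimal arity on the left spine properly below `x`. -/
def tightBelow (μ : ℕ) : ℕ → Node T S → ℕ
  | 0, _ => 0
  | h + 1, x => match x.children with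
    | [] => 0
    | c :: _ => tight μ c + tightBelow μ h c

theorem tightBelow_le (μ h : ℕ) (x : Node T S) : tightBelow μ h x ≤ h := by
  induction h generalizing x with
  | zero => simp [tightBelow]
  | succ h ih =>
    unfold tightBelow
    split
    · omega
    · rename_i c _ _
      have := ih c
      have := tight_le_one μ c
      omega

theorem tightBelow_cons (μ h : ℕ) {x c : Node T S} {cs : List (Node T S)}
    (hx : x.children = c :: cs) :
    tightBelow μ (h + 1) x = tight μ c + tightBelow μ h c := by
  simp only [tightBelow, hx]

/-- The invariants on height and arity, in terms of the stored spines. -/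
structure Shape (μ : ℕ) (f : FiBA T S) : Prop where
  spines : f.left.length = f.right.length
  left : Spine μ 0 f.left
  right : Spine μ 0 f.right
  root_max : f.root.arity ≤ 2 * μ
  root : (f.left = [] ∧ f.root.children = []) ∨
    ∃ k, f.left.length = k + 1 ∧ f.root.children.length + 1 = f.root.entries.length ∧
      ∀ c ∈ f.root.children, Good μ k c

/-- Contents of a spine node stored without its first child. -/
def tailList (p : Node T S) : List (T × S) := weaveE p.entries p.children

theorem toList_attachFirst (p c : Node T S) :
    (attachFirst p c).toList = c.toList ++ tailList p := by
  simp [attachFirst, tailList]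

theorem toList_attachLast {p c : Node T S} (h : p.children.length = p.entries.length) :
    (attachLast p c).toList = p.toList ++ c.toList := by
  simp [attachLast, weave_concat c h, Node.toList_eq p]

theorem good_attachFirst {μ k : ℕ} {p c : Node T S} (hc : Good μ k c) (hp : Half μ (k + 1) p) :
    (attachFirst p c).Balanced μ (k + 1) := by
  rw [balanced_succ]
  refine ⟨by simp [attachFirst, hp.1], fun d hd => ?_⟩
  rcases List.mem_cons.1 hd with rfl | hd
  · exact hc
  · exact hp.2 d hd

theorem good_attachLast {μ k : ℕ} {p c : Node T S} (hc : Good μ k c) (hp : Half μ (k + 1) p) :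
    (attachLast p c).Balanced μ (k + 1) := by
  rw [balanced_succ]
  refine ⟨by simp [attachLast, hp.1], fun d hd => ?_⟩
  rcases List.mem_append.1 hd with hd | hd
  · exact hp.2 d hd
  · obtain rfl := List.mem_singleton.1 hd
    exact hc

/-- Both directions are needed: one to reassemble a subtree from a stored spine, the other to read
the spine invariants off a valid tree. -/
theorem good_foldl_attachFirst {μ k : ℕ} {x : Node T S} {ps : List (Node T S)} :
    Good μ (k + ps.length) (ps.foldl (fun c p => attachFirst p c) x) ↔
      Good μ k x ∧ Spine μ (k + 1) ps := by
  induction ps generalizing k x with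
  | nil => simp [Spine]
  | cons p ps ih =>
    have e : k + (p :: ps).length = k + 1 + ps.length := by simp; omega
    rw [List.foldl_cons, e, ih]
    simp only [Spine, Half]
    constructor
    · rintro ⟨⟨h1, h2, h3⟩, h4⟩
      rw [balanced_succ] at h3
      exact ⟨h3.2 x (by simp [attachFirst]), ⟨h1, h2⟩,
        ⟨by simpa [attachFirst] using h3.1, fun c hc => h3.2 c (by simp [attachFirst, hc])⟩, h4⟩
    · rintro ⟨h1, h2, h3, h4⟩
      exact ⟨⟨h2.1, h2.2, good_attachFirst h1 h3⟩, h4⟩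

theorem good_foldl_attachLast {μ k : ℕ} {x : Node T S} {ps : List (Node T S)} :
    Good μ (k + ps.length) (ps.foldl (fun c p => attachLast p c) x) ↔
      Good μ k x ∧ Spine μ (k + 1) ps := by
  induction ps generalizing k x with
  | nil => simp [Spine]
  | cons p ps ih =>
    have e : k + (p :: ps).length = k + 1 + ps.length := by simp; omega
    rw [List.foldl_cons, e, ih]
    simp only [Spine, Half]
    constructor
    · rintro ⟨⟨h1, h2, h3⟩, h4⟩
      rw [balanced_succ] at h3
      exact ⟨h3.2 x (by simp [attachLast]), ⟨h1, h2⟩,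
        ⟨by simpa [attachLast] using h3.1, fun c hc => h3.2 c (by simp [attachLast, hc])⟩, h4⟩
    · rintro ⟨h1, h2, h3, h4⟩
      exact ⟨⟨h2.1, h2.2, good_attachLast h1 h3⟩, h4⟩

theorem toList_foldl_attachFirst (x : Node T S) (ps : List (Node T S)) :
    (ps.foldl (fun c p => attachFirst p c) x).toList = x.toList ++ ps.flatMap tailList := by
  induction ps generalizing x with
  | nil => simp
  | cons p ps ih => simp [ih, toList_attachFirst]

theorem toList_foldl_attachLast {μ k : ℕ} (x : Node T S) {ps : List (Node T S)}
    (h : Spine μ (k + 1) ps) :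
    (ps.foldl (fun c p => attachLast p c) x).toList =
      ps.reverse.flatMap Node.toList ++ x.toList := by
  induction ps generalizing x k with
  | nil => simp
  | cons p ps ih => simp [ih _ h.2.2, toList_attachLast h.2.1.1]

/-- Arity counts entries, so it does not notice the missing first child. Hence the potential can be
read either from the stored spine or from the complete tree. -/
theorem tightBelow_foldl_attachFirst (μ k : ℕ) (x : Node T S) (ps : List (Node T S)) :
    let y := ps.foldl (fun c p => attachFirst p c) x
    tight μ y + tightBelow μ (k + ps.length) y =
      tight μ x + tightBelow μ k x + tightCount μ ps := by
  induction ps generalizing x k with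
  | nil => simp [tightCount]
  | cons p ps ih =>
    have e : k + (p :: ps).length = k + 1 + ps.length := by simp; omega
    simp only [List.foldl_cons, e] at ih ⊢
    rw [ih (k + 1), tightBelow_cons μ k (c := x) (cs := p.children) (by simp [attachFirst]),
      tightCount_cons]
    have : tight μ (attachFirst p x) = tight μ p := rfl
    rw [this]
    omega

theorem Spine.arity_sum_le {μ k : ℕ} {ps : List (Node T S)} (h : Spine μ k ps) :
    (ps.map Node.arity).sum ≤ 2 * μ * ps.length := by
  induction ps generalizing k with
  | nil => simp
  | cons p ps ih =>
    have := ih h.2.2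
    have := h.1.2
    simp only [List.map_cons, List.sum_cons, List.length_cons]
    linarith

theorem tightCount_le_length (μ : ℕ) (ps : List (Node T S)) : tightCount μ ps ≤ ps.length :=
  List.countP_le_length

theorem leaf_tailList {x : Node T S} (h : x.children = []) : tailList x = x.toList := by
  simp [tailList, Node.toList_eq, h]

/-- Only two children and one entry per inner node are used. All logarithms in the theorem come from
this bound. -/
theorem Good.length_toList {μ h : ℕ} (hμ : 2 ≤ μ) {x : Node T S} (hx : Good μ h x) :
    2 ^ (h + 1) ≤ x.toList.length + 1 := by
  induction h generalizing x with
  | zero =>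
    have h1 := hx.1
    have h2 := balanced_zero.1 hx.2.2
    rw [Node.arity] at h1
    rw [Node.toList_eq, h2]
    simp
    omega
  | succ h ih =>
    have h1 := hx.1
    have h2 := balanced_succ.1 hx.2.2
    rw [Node.arity] at h1
    rw [Node.toList_eq]
    generalize x.entries = es at *
    generalize x.children = cs at *
    match cs, es with
    | [], _ => simp at h2
    | _, [] => simp at h1; omega
    | [c], e :: es => simp at h2
    | c :: d :: cs, e :: es =>
      have hc := ih (h2.2 c (by simp))
      have hd := ih (h2.2 d (by simp))
      simp only [weave_cons, weaveE_cons, List.length_append, List.length_cons]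
      rw [pow_succ]
      omega

/-! ### The stored form and the complete tree -/

/-- Evictions work on the stored spines, insertions on the complete tree; this equivalence moves
between the two forms. -/
theorem shape_iff {μ : ℕ} {f : FiBA T S} :
    Shape μ f ↔ f.left.length = f.right.length ∧ RootTree μ f.left.length f.toTree := by
  obtain ⟨left, root, right⟩ := f
  constructor
  · rintro ⟨h1, h2, h3, h4, h5⟩
    refine ⟨h1, ?_⟩
    simp only at *
    rcases h5 with ⟨rfl, h5⟩ | ⟨k, h5, h6, h7⟩
    · obtain rfl : right = [] := by simpa using h1.symm
      exact ⟨by simpa [toTree, balanced_zero, leftSubtree, rightSubtree] using h5, h4,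
        Or.inr rfl⟩
    · match left, right with
      | [], _ => simp at h5
      | l :: ls, [] => simp at h1
      | l :: ls, r :: rs =>
        have hls : ls.length = k := by simpa using h5
        have hrs : rs.length = k := by simp at h1; omega
        rw [h5]
        refine ⟨?_, h4, Or.inl (by simp [toTree]; omega)⟩
        rw [balanced_succ]
        have hL := (good_foldl_attachFirst (μ := μ) (k := 0) (x := l) (ps := ls)).2
          ⟨⟨h2.1.1, h2.1.2, h2.2.1⟩, h2.2.2⟩
        have hR := (good_foldl_attachLast (μ := μ) (k := 0) (x := r) (ps := rs)).2
          ⟨⟨h3.1.1, h3.1.2, h3.2.1⟩, h3.2.2⟩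
        rw [zero_add, hls] at hL
        rw [zero_add, hrs] at hR
        simp only [toTree, leftSubtree, rightSubtree, Option.toList, Node.children_mk,
          Node.entries_mk]
        refine ⟨by simp; omega, fun c hc => ?_⟩
        simp only [List.mem_append, List.mem_singleton] at hc
        rcases hc with (rfl | hc) | rfl
        · exact hL
        · exact h7 c hc
        · exact hR
  · rintro ⟨h1, h2, h3, h4⟩
    simp only at *
    match left, right with
    | [], _ :: _ => simp at h1
    | l :: ls, [] => simp at h1
    | [], [] =>
      exact ⟨rfl, trivial, trivial, h3, Or.inl ⟨rfl, by
        simpa [toTree, balanced_zero, leftSubtree, rightSubtree] using h2⟩⟩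
    | l :: ls, r :: rs =>
      have hrs : rs.length = ls.length := by simp at h1; omega
      rw [List.length_cons, balanced_succ] at h2
      simp only [toTree, leftSubtree, rightSubtree, Option.toList, Node.children_mk,
        Node.entries_mk] at h2
      have hL := h2.2 _ (by simp; exact Or.inl rfl)
      have hR := h2.2 _ (by simp; exact Or.inr (Or.inr rfl))
      rw [← zero_add ls.length, good_foldl_attachFirst] at hL
      rw [← zero_add ls.length, ← hrs, good_foldl_attachLast] at hR
      exact ⟨h1, ⟨⟨hL.1.1, hL.1.2.1⟩, hL.1.2.2, hL.2⟩, ⟨⟨hR.1.1, hR.1.2.1⟩, hR.1.2.2, hR.2⟩,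
        h3, Or.inr ⟨ls.length, rfl, by have := h2.1; simp at this; simp; omega,
          fun c hc => h2.2 c (by simp at hc; simp [hc])⟩⟩

/-- The left spine read upwards is already in window order; the right spine has to be reversed. -/
theorem Shape.window_eq {μ : ℕ} {f : FiBA T S} (hf : Shape μ f) :
    f.window = f.left.flatMap tailList ++ tailList f.root ++
      f.right.reverse.flatMap Node.toList := by
  obtain ⟨left, root, right⟩ := f
  obtain ⟨h1, h2, h3, -, h5⟩ := hf
  simp only at *
  rcases h5 with ⟨rfl, h5⟩ | ⟨k, h5, h6, h7⟩
  · obtain rfl : right = [] := by simpa using h1.symm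
    simp [window, toTree, leftSubtree, rightSubtree, h5, tailList]
  · match left, right with
    | [], _ => simp at h5
    | l :: ls, [] => simp at h1
    | l :: ls, r :: rs =>
      simp only [window, toTree, leftSubtree, rightSubtree, Option.toList, List.cons_append,
        List.nil_append, Node.toList_mk, weave_cons, weaveE_concat _ h6,
        toList_foldl_attachFirst, toList_foldl_attachLast r h3.2.2, List.flatMap_cons,
        leaf_tailList h2.2.1, List.reverse_cons, List.flatMap_append, List.flatMap_nil,
        List.append_nil, List.append_assoc]
      rfl

theorem tightBelow_toTree {μ : ℕ} {f : FiBA T S} :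
    tightBelow μ f.left.length f.toTree = tightCount μ f.left := by
  obtain ⟨left, root, right⟩ := f
  match left with
  | [] => simp [tightBelow, tightCount]
  | l :: ls =>
    simp only [List.length_cons]
    rw [tightBelow_cons μ ls.length (c := ls.foldl (fun c p => attachFirst p c) l)
      (cs := root.children ++ (rightSubtree right).toList) (by simp [toTree, leftSubtree])]
    have := tightBelow_foldl_attachFirst μ 0 l ls
    simp only [zero_add, tightBelow, add_zero] at this
    rw [this, tightCount_cons]

/-- The complete subtree at the left finger has height one less than the tree, which cancels the
extra one in the exponent of `Good.length_toList`. The entries outside this subtree are not needed.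
-/
theorem Shape.length_window {μ : ℕ} (hμ : 2 ≤ μ) {f : FiBA T S} (hf : Shape μ f) :
    2 ^ f.left.length ≤ (f.left.flatMap tailList).length + 1 := by
  obtain ⟨left, root, right⟩ := f
  match left, hf with
  | [], _ => simp
  | l :: ls, hf =>
    have h2 := hf.left
    have hL := (good_foldl_attachFirst (μ := μ) (k := 0) (x := l) (ps := ls)).2
      ⟨⟨h2.1.1, h2.1.2, h2.2.1⟩, h2.2.2⟩
    have := hL.length_toList hμ
    rw [toList_foldl_attachFirst] at this
    simpa [leaf_tailList (h2.2.1 : l.children = [])] using this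

/-! ### Passing down the spines -/

section PassDown

variable [Monoid S]

/-- The pass rewrites aggregates and detaches first children but keeps every entry list, so contents
and tightness survive. -/
theorem passDownLeft_spec {μ h : ℕ} (pa : S) {x : Node T S} {acc : List (Node T S)}
    (hx : Good μ h x) (hacc : Spine μ (h + 1) acc) :
    Spine μ 0 (passDownLeft pa x acc).val ∧
      (passDownLeft pa x acc).val.length = h + 1 + acc.length ∧
      (passDownLeft pa x acc).val.flatMap tailList = x.toList ++ acc.flatMap tailList ∧
      tightCount μ (passDownLeft pa x acc).val = tight μ x + tightBelow μ h x + tightCount μ acc ∧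
      (passDownLeft pa x acc).time ≤ (1 + 4 * μ) * (h + 1) := by
  induction h generalizing pa x acc with
  | zero =>
    obtain ⟨a, es, cs⟩ := x
    obtain rfl : cs = [] := balanced_zero.1 hx.2.2
    have h2 := hx.2.1
    have e : passDownLeft pa (Node.mk a es []) acc =
        ⟨Node.mk (entryFirst es [] * pa) es [] :: acc, 1 + 2 * (es.length + 1)⟩ := by
      rw [passDownLeft]; rfl
    rw [e]
    refine ⟨⟨⟨hx.1, h2⟩, rfl, hacc⟩, ?_, ?_, ?_, ?_⟩
    · simp; omega
    · simp [tailList]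
    · simp only [tightCount_cons, tightBelow, add_zero]; rfl
    · simp at h2 ⊢; omega
  | succ h ih =>
    obtain ⟨a, es, cs⟩ := x
    have h2 := hx.2.1
    have h3 := balanced_succ.1 hx.2.2
    simp only [Node.children_mk, Node.entries_mk, Node.arity_mk] at h2 h3
    cases cs with
    | nil => simp at h3
    | cons c cs =>
      set q : Node T S := Node.mk (entryFirst es cs * pa) es cs with hq
      have e : passDownLeft pa (Node.mk a es (c :: cs)) acc =
          ⟨(passDownLeft (entryFirst es cs * pa) c (q :: acc)).val,
            1 + 2 * (es.length + 1) +
              (passDownLeft (entryFirst es cs * pa) c (q :: acc)).time⟩ := by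
        rw [passDownLeft]; rfl
      obtain ⟨i1, i2, i3, i4, i5⟩ := ih (entryFirst es cs * pa) (h3.2 c (by simp))
        (acc := q :: acc) ⟨⟨hx.1, h2⟩, ⟨by simpa [hq] using h3.1,
          fun d hd => h3.2 d (List.mem_cons_of_mem _ hd)⟩, hacc⟩
      rw [e]
      refine ⟨i1, ?_, ?_, ?_, ?_⟩
      · rw [i2]; simp; omega
      · simp only [i3, List.flatMap_cons]
        simp [tailList, hq]
      · simp only
        rw [i4, tightCount_cons, tightBelow_cons μ h (c := c) (cs := cs) rfl]
        have : tight μ q = tight μ (Node.mk a es (c :: cs)) := rfl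
        omega
      · simp only
        linarith

theorem passDownRight_spec {μ h : ℕ} (pa : S) {x : Node T S} {acc : List (Node T S)}
    (hx : Good μ h x) (hacc : Spine μ (h + 1) acc) :
    Spine μ 0 (passDownRight pa x acc).val ∧
      (passDownRight pa x acc).val.length = h + 1 + acc.length ∧
      (passDownRight pa x acc).val.reverse.flatMap Node.toList =
        acc.reverse.flatMap Node.toList ++ x.toList ∧
      (passDownRight pa x acc).time ≤ (1 + 6 * μ) * (h + 1) := by
  induction h generalizing pa x acc with
  | zero =>
    obtain ⟨a, es, cs⟩ := x
    obtain rfl : cs = [] := balanced_zero.1 hx.2.2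
    have h2 := hx.2.1
    have e : passDownRight pa (Node.mk a es []) acc =
        ⟨Node.mk (pa * childFirst es []) es [] :: acc, 1 + 3 * (es.length + 1)⟩ := by
      rw [passDownRight]; rfl
    rw [e]
    refine ⟨⟨⟨hx.1, h2⟩, rfl, hacc⟩, ?_, ?_, ?_⟩
    · simp; omega
    · simp
    · simp at h2 ⊢; omega
  | succ h ih =>
    obtain ⟨a, es, cs⟩ := x
    have h2 := hx.2.1
    have h3 := balanced_succ.1 hx.2.2
    simp only [Node.children_mk, Node.entries_mk, Node.arity_mk] at h2 h3
    rcases List.eq_nil_or_concat' cs with rfl | ⟨cs, c, rfl⟩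
    · simp at h3
    · set q : Node T S := Node.mk (pa * childFirst es cs) es cs with hq
      have hlen : cs.length = es.length := by simpa using h3.1
      have e : (passDownRight pa (Node.mk a es (cs ++ [c])) acc).val =
          (passDownRight (pa * childFirst es cs) c (q :: acc)).val ∧
          (passDownRight pa (Node.mk a es (cs ++ [c])) acc).time =
          1 + 3 * (es.length + 1) +
              (passDownRight (pa * childFirst es cs) c (q :: acc)).time := by
        rw [passDownRight]
        simp only [Timed.val_bind, Timed.time_bind, Timed.time_tick, Node.arity_mk]
        split
        · rename_i h; simp at h
        · rename_i d h
          obtain rfl : c = d := by simpa using h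
          simp [hq]
      obtain ⟨i1, i2, i3, i5⟩ := ih (pa * childFirst es cs) (h3.2 c (by simp))
        (acc := q :: acc) ⟨⟨hx.1, h2⟩, ⟨hlen, fun d hd => h3.2 d (List.mem_append_left _ hd)⟩, hacc⟩
      rw [e.1, e.2]
      refine ⟨i1, ?_, ?_, ?_⟩
      · rw [i2]; simp; omega
      · rw [i3]
        simp [hq, weave_concat c hlen]
      · linarith

/-- The new root itself is not on the stored left spine, so only tight nodes properly below it
count. -/
theorem makeRoot_spec {μ h : ℕ} (hμ : 2 ≤ μ) {x : Node T S} (hx : RootTree μ h x) :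
    Shape μ (makeRoot x).val ∧ (makeRoot x).val.window = x.toList ∧
      (makeRoot x).val.left.length = h ∧
      tightCount μ (makeRoot x).val.left = tightBelow μ h x ∧
      (makeRoot x).time ≤ 12 * μ * (h + 1) := by
  obtain ⟨a, es, cs⟩ := x
  have h2 := hx.arity_le
  cases h with
  | zero =>
    obtain rfl : cs = [] := balanced_zero.1 hx.balanced
    have e : makeRoot (Node.mk a es ([] : List (Node T S))) =
      ⟨⟨[], .mk (entryFirst es []) es [], []⟩, 1 + 3 * (es.length + 1)⟩ := rfl
    have hs : Shape μ (makeRoot (Node.mk a es ([] : List (Node T S)))).val := by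
      rw [e]; exact ⟨rfl, trivial, trivial, h2, Or.inl ⟨rfl, rfl⟩⟩
    refine ⟨hs, ?_, ?_, ?_, ?_⟩
    · rw [hs.window_eq, e]; simp [tailList]
    · rw [e]; rfl
    · rw [e]; rfl
    · rw [e]; simp at h2 ⊢; omega
  | succ h =>
    have h3 := balanced_succ.1 hx.balanced
    have h4 := hx.two_le
    simp only [Node.children_mk, Node.entries_mk, Node.arity_mk] at h2 h3 h4
    rcases cs with _ | ⟨c, cs⟩
    · simp at h3
    rcases List.eq_nil_or_concat' cs with rfl | ⟨cs, d, rfl⟩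
    · have := h3.1
      simp only [List.length_cons, List.length_nil] at this
      omega
    · obtain ⟨i1, i2, i3, i4, i5⟩ := passDownLeft_spec (1 : S) (h3.2 c (by simp)) (acc := [])
        trivial
      obtain ⟨j1, j2, j3, j5⟩ := passDownRight_spec (1 : S) (h3.2 d (by simp)) (acc := [])
        trivial
      have e : makeRoot (Node.mk a es (c :: (cs ++ [d]))) =
        ⟨⟨(passDownLeft 1 c []).val, .mk (entryFirst es cs) es cs, (passDownRight 1 d []).val⟩,
          1 + 3 * (es.length + 1) + ((passDownLeft 1 c []).time +
            ((passDownRight 1 d []).time + 0))⟩ := by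
        unfold makeRoot
        simp only [Node.children_mk, List.getLast?_concat, List.dropLast_concat]
        rfl
      have hlen : cs.length + 1 = es.length := by
        have := h3.1; simp at this; omega
      have hs : Shape μ (makeRoot (Node.mk a es (c :: (cs ++ [d])))).val := by
        rw [e]
        refine ⟨by simp [i2, j2], i1, j1, h2, Or.inr ⟨h, by simp [i2], hlen,
          fun d hd => h3.2 d (by simp at hd; simp [hd])⟩⟩
      refine ⟨hs, ?_, ?_, ?_, ?_⟩
      · rw [hs.window_eq, e]
        simp only [i3, j3]
        simp [tailList, weaveE_concat d hlen]
      · rw [e]; simp [i2]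
      · rw [e]
        simp only
        rw [i4, tightBelow_cons μ h (c := c) (cs := cs ++ [d]) rfl]
        simp [tightCount]
      · rw [e]
        simp only
        nlinarith

end PassDown

/-! ### Rebalancing -/

/-- Contents of a separating entry with the neighbor after it. -/
def neighborList : Option ((T × S) × Node T S) → List (T × S)
  | none => []
  | some (s, y) => s :: y.toList

/-- The outcome of a level of height `h` with neighbor `nb` has the right shape, and no entries
other than those of `l`, in the same order. -/
def Outcome.Fits (μ h : ℕ) (l : List (T × S)) :
    Option ((T × S) × Node T S) → Outcome T S → Prop
  | none, o => ∃ r, o = .root r ∧ (∃ h' ≤ h, RootTree μ h' r) ∧ r.toList.Sublist l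
  | some _, o =>
    (∃ x s y, o = .two x s y ∧ Good μ h x ∧ Good μ h y ∧
      (x.toList ++ s :: y.toList).Sublist l) ∨
    (∃ y, o = .one y ∧ Good μ h y ∧ y.toList.Sublist l)

theorem Outcome.Fits.mono {μ h : ℕ} {l l' : List (T × S)} {nb nb' : Option ((T × S) × Node T S)}
    {o : Outcome T S} (ho : o.Fits μ h l nb) (hl : l.Sublist l') (hnb : nb.isSome = nb'.isSome) :
    o.Fits μ h l' nb' := by
  match nb, nb', hnb with
  | none, none, _ =>
    obtain ⟨r, h1, h2, h3⟩ := ho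
    exact ⟨r, h1, h2, h3.trans hl⟩
  | some p, some q, _ =>
    rcases ho with ⟨x, s, y, h1, h2, h3, h4⟩ | ⟨y, h1, h2, h3⟩
    · exact Or.inl ⟨x, s, y, h1, h2, h3, h4.trans hl⟩
    · exact Or.inr ⟨y, h1, h2, h3.trans hl⟩

section Evict

variable [Monoid S]

theorem good_recompute {μ h : ℕ} {y : Node T S} (hy : Good μ h y) :
    Good μ h (recompute y).val :=
  ⟨hy.1, hy.2.1, Balanced.congr hy.2.2 rfl rfl⟩

theorem toList_recompute (y : Node T S) : (recompute y).val.toList = y.toList := by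
  rw [Node.toList_eq, Node.toList_eq y]; rfl

/-- A deficit covered by the surplus brings the node to exactly $\mu$ and leaves the neighbor at
least $\mu$; otherwise the two arities add up to less than $2\mu$, and merging is possible. -/
theorem rebalance_spec {μ h : ℕ} (hμ : 2 ≤ μ) {x : Node T S}
    {nb : Option ((T × S) × Node T S)} (hx : x.Balanced μ h) (hx2 : x.arity ≤ 2 * μ)
    (hnb : ∀ p ∈ nb, Good μ h p.2) :
    (rebalance μ x nb).val.Fits μ h (x.toList ++ neighborList nb) nb ∧
      (rebalance μ x nb).time ≤ 2 + 6 * μ := by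
  obtain ⟨a, es, cs⟩ := x
  match nb with
  | none =>
    simp only [neighborList, List.append_nil, Outcome.Fits]
    by_cases hc : es = [] ∧ ∃ c, cs = [c]
    -- A node of arity 1 hands over to its only child, which lies one level lower; this is why
    -- `Fits` allows a smaller height.
    · obtain ⟨rfl, c, rfl⟩ := hc
      refine ⟨⟨c, rfl, ?_, by simp⟩, by simp [rebalance]⟩
      cases h with
      | zero => simp [balanced_zero] at hx
      | succ h =>
        have hg := (balanced_succ.1 hx).2 c (by simp)
        exact ⟨h, by omega, hg.2.2, hg.2.1, Or.inl (hμ.trans hg.1)⟩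
    · have e : rebalance μ (Node.mk a es cs) none = ⟨.root (Node.mk a es cs), 2 + 0⟩ := by
        match es, cs with
        | [], [] => rfl
        | [], [c] => exact absurd ⟨rfl, c, rfl⟩ hc
        | [], _ :: _ :: _ => rfl
        | _ :: _, [] => rfl
        | _ :: _, _ :: _ => rfl
      rw [e]
      refine ⟨⟨_, rfl, ⟨h, le_rfl, hx, hx2, ?_⟩, List.Sublist.refl _⟩, by simp⟩
      cases h with
      | zero => exact Or.inr rfl
      | succ h =>
        left
        have h3 := (balanced_succ.1 hx).1
        simp only [Node.children_mk, Node.entries_mk, Node.arity_mk] at *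
        by_contra hlt
        have : es = [] := List.length_eq_zero_iff.1 (by omega)
        subst this
        exact hc ⟨rfl, List.length_eq_one_iff.1 (by simpa using h3)⟩
  | some (s, y) =>
    have hy : Good μ h y := hnb (s, y) rfl
    simp only [neighborList, rebalance]
    split_ifs with h1 h2
    · refine ⟨Or.inl ⟨_, _, _, rfl, ⟨h1, hx2, hx⟩, good_recompute hy, ?_⟩, ?_⟩
      · rw [toList_recompute]
      · have := hy.2.1
        simp [recompute]
        omega
    · obtain ⟨b, ys, ds⟩ := y
      have hy1 := hy.1
      have hy2 := hy.2.1
      simp only [Node.arity_mk] at *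
      -- The old separator supplies one of the entries moved, so a deficit $d$ takes $d$ children
      -- but only $d-1$ entries from the neighbor, and its entry number $d-1$ becomes the new
      -- separator.
      obtain ⟨s', zs, hzs⟩ : ∃ s' zs, ys.drop (μ - (es.length + 1) - 1) = s' :: zs :=
        ⟨_, _, List.drop_eq_getElem_cons (by omega)⟩
      have hzl := congrArg List.length hzs
      obtain ⟨b1, b2, b3⟩ := Balanced.split hy.2.2 hzs b b
      have hk : μ - (es.length + 1) - 1 + 1 = μ - (es.length + 1) := by omega
      rw [hk] at b1 b2 b3
      obtain ⟨c1, c2⟩ := Balanced.join a s hx b1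
      simp only [moveBatch, Timed.val_bind, Timed.time_bind, Node.entries_mk, hzs,
        Node.children_mk, Node.agg_mk]
      simp only [List.length_drop, List.length_cons] at hzl
      refine ⟨Or.inl ⟨_, _, _, rfl, ⟨?_, ?_, c1⟩, good_recompute ⟨?_, ?_, b2⟩, ?_⟩, ?_⟩
      · simp; omega
      · simp; omega
      · simp; omega
      · simp; omega
      · rw [toList_recompute]
        simp [c2, b3]
      · simp [recompute]
        omega
    -- The failed test says that the sum of both arities is below $2\mu$, and with the separator
    -- that sum is exactly the arity of the merged node.
    · obtain ⟨b, ys, ds⟩ := y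
      have hy1 := hy.1
      have hy2 := hy.2.1
      simp only [Node.arity_mk] at *
      obtain ⟨c1, c2⟩ := Balanced.join b s hx hy.2.2
      refine ⟨Or.inr ⟨_, rfl, good_recompute ⟨?_, ?_, c1⟩, ?_⟩, ?_⟩
      · simp; omega
      · simp; omega
      · rw [toList_recompute]
        simp [c2]
      · simp [recompute, mergeNotSibling]
        omega

/-- Rebalancing an underfull node keeps its first child first; a merged node is not tight. -/
theorem rebalance_tight {μ h : ℕ} {x : Node T S} {p : (T × S) × Node T S} {c : Node T S}
    {cs : List (Node T S)} (hx : x.children = c :: cs) (hlt : x.arity < μ)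
    (hy : Good μ h p.2) :
    (∀ x' s y, (rebalance μ x (some p)).val = .two x' s y → ∃ cs', x'.children = c :: cs') ∧
    (∀ y, (rebalance μ x (some p)).val = .one y → tight μ y = 0 ∧ ∃ cs', y.children = c :: cs') := by
  obtain ⟨a, es, _⟩ := x
  simp only [Node.children_mk] at hx
  subst hx
  obtain ⟨s, b, ys, ds⟩ := p
  have hy1 := hy.1
  simp only [Node.arity_mk] at hlt hy1
  have h1 : ¬ μ ≤ (Node.mk a es (c :: cs)).arity := by simp; omega
  simp only [rebalance, Timed.val_bind, if_neg h1]
  split_ifs with h2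
  · simp only [Node.arity_mk] at h2
    obtain ⟨s', zs, hzs⟩ : ∃ s' zs, ys.drop (μ - (es.length + 1) - 1) = s' :: zs :=
      ⟨_, _, List.drop_eq_getElem_cons (by omega)⟩
    simp only [moveBatch, Timed.val_bind, Node.entries_mk, hzs, Node.arity_mk,
      Node.children_mk, Node.agg_mk]
    refine ⟨fun x' s y hxy => ?_, fun y hy => ?_⟩
    · cases hxy
      exact ⟨_, rfl⟩
    · cases hy
  · refine ⟨fun x' s y hxy => (by cases hxy), fun y hy => ?_⟩
    cases hy
    -- The neighbor already has arity at least $\mu$, and the separator adds at least one entry.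
    refine ⟨if_neg ?_, _, rfl⟩
    change ¬ (es ++ s :: ys).length + 1 = μ
    simp
    omega

/-! ### Eviction along the boundary -/

theorem evictBottom_spec {μ h : ℕ} (hμ : 2 ≤ μ) {fr : Frame T S} (hx : fr.node.Balanced μ h)
    (hx2 : fr.node.arity ≤ 2 * μ) (hcut : fr.cut ≤ fr.node.entries.length)
    (hnb : ∀ p ∈ fr.neighbor, Good μ h p.2) :
    (evictBottom μ fr).val.Fits μ h (fr.node.toList ++ neighborList fr.neighbor) fr.neighbor ∧
      (evictBottom μ fr).time ≤ 2 + 10 * μ := by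
  obtain ⟨⟨a, es, cs⟩, cut, nb⟩ := fr
  obtain ⟨h1, h2⟩ := Balanced.drop hx hcut a
  obtain ⟨i1, i2⟩ := rebalance_spec hμ h1 (by simp at hx2 ⊢; omega) hnb
  refine ⟨i1.mono ?_ rfl, ?_⟩
  · simpa using List.Sublist.append_right h2 (neighborList nb)
  · simp only [evictBottom, Timed.time_bind, Timed.time_tick, Node.agg_mk, Node.entries_mk,
      Node.children_mk] at *
    omega

/-- Here the separator of the level below is an entry of this very node. Child and right sibling are
replaced together, so the node loses one entry if they merged and none otherwise. -/
theorem evictLevel_inner_spec {μ h : ℕ} (hμ : 2 ≤ μ) {fr : Frame T S} {low : Outcome T S}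
    (hx : fr.node.Balanced μ (h + 1)) (hx2 : fr.node.arity ≤ 2 * μ)
    {e : T × S} {es : List (T × S)} {c d : Node T S} {cs : List (Node T S)}
    (hes : fr.node.entries.drop fr.cut = e :: es)
    (hcs : fr.node.children.drop fr.cut = c :: d :: cs)
    (hlow : low.Fits μ h (c.toList ++ e :: d.toList) (some (e, d)))
    (hnb : ∀ p ∈ fr.neighbor, Good μ (h + 1) p.2) :
    (evictLevel μ fr low).val.Fits μ (h + 1) (fr.node.toList ++ neighborList fr.neighbor)
        fr.neighbor ∧
      (evictLevel μ fr low).time ≤ 2 + 10 * μ := by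
  obtain ⟨⟨a, es₀, cs₀⟩, cut, nb⟩ := fr
  simp only [Node.entries_mk, Node.children_mk, Node.arity_mk] at *
  have hcut : cut ≤ es₀.length := by
    have := congrArg List.length hes
    simp at this
    omega
  have hel : es.length + 1 ≤ es₀.length := by
    have := congrArg List.length hes
    simp at this
    omega
  obtain ⟨h1, h2⟩ := Balanced.drop hx hcut a
  have hcs' : cs₀.drop (cut + 2) = cs := by
    rw [← List.drop_drop, hcs]; rfl
  rw [hes, hcs] at h1 h2
  rw [balanced_succ] at h1
  simp only [Node.entries_mk, Node.children_mk] at h1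
  rcases hlow with ⟨x', s', y', rfl, hx', hy', hl⟩ | ⟨y', rfl, hy', hl⟩
  · have hb : (Node.mk a (s' :: es) (x' :: y' :: cs)).Balanced μ (h + 1) := by
      rw [balanced_succ]
      refine ⟨by simpa using h1.1, fun z hz => ?_⟩
      simp only [Node.children_mk, List.mem_cons] at hz
      rcases hz with rfl | rfl | hz
      · exact hx'
      · exact hy'
      · exact h1.2 z (by simp [hz])
    obtain ⟨i1, i2⟩ := rebalance_spec hμ hb (by simp; omega) hnb
    have e : evictLevel μ ⟨Node.mk a es₀ cs₀, cut, nb⟩ (.two x' s' y') =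
        ⟨(rebalance μ (.mk a (s' :: es) (x' :: y' :: cs)) nb).val, 2 * (es₀.length + 1) +
          (rebalance μ (.mk a (s' :: es) (x' :: y' :: cs)) nb).time⟩ := by
      unfold evictLevel
      simp only [Node.entries_mk, Node.children_mk, hes, hcs']
      rfl
    rw [e]
    refine ⟨i1.mono (List.Sublist.append_right ?_ _) rfl, by simp only; omega⟩
    refine List.Sublist.trans ?_ (by simpa using h2)
    have := List.Sublist.append_right hl (weaveE es cs)
    simpa using this
  · have hb : (Node.mk a es (y' :: cs)).Balanced μ (h + 1) := by
      rw [balanced_succ]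
      refine ⟨by simpa using h1.1, fun z hz => ?_⟩
      simp only [Node.children_mk, List.mem_cons] at hz
      rcases hz with rfl | hz
      · exact hy'
      · exact h1.2 z (by simp [hz])
    obtain ⟨i1, i2⟩ := rebalance_spec hμ hb (by simp; omega) hnb
    have e : evictLevel μ ⟨Node.mk a es₀ cs₀, cut, nb⟩ (.one y') =
        ⟨(rebalance μ (.mk a es (y' :: cs)) nb).val, 2 * (es₀.length + 1) +
          (rebalance μ (.mk a es (y' :: cs)) nb).time⟩ := by
      unfold evictLevel
      simp only [Node.entries_mk, Node.children_mk, hes, hcs']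
      rfl
    rw [e]
    refine ⟨i1.mono (List.Sublist.append_right ?_ _) rfl, by simp only; omega⟩
    refine List.Sublist.trans ?_ (by simpa using h2)
    have := List.Sublist.append_right hl (weaveE es cs)
    simpa using this

/-- Only the last child is left, so the level below interacted with the first child of this node's
neighbor, through the same separator. If the two merged, nothing of this node remains and the
separator is gone as well. -/
theorem evictLevel_last_spec {μ h : ℕ} (hμ : 2 ≤ μ) {fr : Frame T S} {low : Outcome T S}
    (hx : fr.node.Balanced μ (h + 1)) (hx2 : fr.node.arity ≤ 2 * μ)
    {c : Node T S} (hcut : fr.cut = fr.node.entries.length)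
    (hcs : fr.node.children.drop fr.cut = [c])
    {s : T × S} {y d : Node T S} {ds : List (Node T S)}
    (hnb : fr.neighbor = some (s, y)) (hy : Good μ (h + 1) y) (hd : y.children = d :: ds)
    (hlow : low.Fits μ h (c.toList ++ s :: d.toList) (some (s, d))) :
    (evictLevel μ fr low).val.Fits μ (h + 1) (fr.node.toList ++ neighborList fr.neighbor)
        fr.neighbor ∧
      (evictLevel μ fr low).time ≤ 2 + 10 * μ := by
  obtain ⟨⟨a, es₀, cs₀⟩, cut, nb⟩ := fr
  obtain ⟨b, ys, ds'⟩ := y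
  simp only [Node.entries_mk, Node.children_mk, Node.arity_mk] at *
  subst hnb hd hcut
  obtain ⟨h1, h2⟩ := Balanced.drop hx le_rfl a
  rw [List.drop_length, hcs] at h1 h2
  have hy0 := balanced_succ.1 hy.2.2
  have hset : ∀ d', Good μ h d' →
      Good μ (h + 1) (setFirst (Node.mk b ys (d :: ds)) d') := by
    intro d' hd'
    refine ⟨hy.1, hy.2.1, balanced_succ.2 ⟨by simpa [setFirst] using hy0.1, fun z hz => ?_⟩⟩
    simp only [setFirst, Node.children_mk, List.mem_cons, List.drop_succ_cons,
      List.drop_zero] at hz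
    rcases hz with rfl | hz
    · exact hd'
    · exact hy0.2 z (by simp [hz])
  rcases hlow with ⟨x', s', y', rfl, hx', hy', hl⟩ | ⟨y', rfl, hy', hl⟩
  · have hb : (Node.mk a [] [x']).Balanced μ (h + 1) := by
      rw [balanced_succ]
      simpa using hx'
    obtain ⟨i1, i2⟩ := rebalance_spec hμ
      (nb := some (s', setFirst (Node.mk b ys (d :: ds)) y')) hb (by simp; omega)
      (fun p hp => by
        obtain rfl := (Option.some.injEq _ _).mp hp
        exact hset y' hy')
    have e : evictLevel μ ⟨Node.mk a es₀ cs₀, es₀.length, some (s, Node.mk b ys (d :: ds))⟩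
          (.two x' s' y') =
        ⟨(rebalance μ (.mk a [] [x'])
            (some (s', setFirst (Node.mk b ys (d :: ds)) y'))).val, 2 * (es₀.length + 1) +
          (rebalance μ (.mk a [] [x'])
            (some (s', setFirst (Node.mk b ys (d :: ds)) y'))).time⟩ := by
      unfold evictLevel
      simp only [Node.entries_mk, List.drop_length]
      rfl
    rw [e]
    refine ⟨i1.mono ?_ rfl, by simp only; omega⟩
    have := (List.Sublist.append_right hl (weaveE ys ds)).trans
      (l₃ := weave es₀ cs₀ ++ s :: (d.toList ++ weaveE ys ds))
      (by simpa using List.Sublist.append_right h2 (s :: (d.toList ++ weaveE ys ds)))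
    simpa [neighborList, setFirst] using this
  · have e : evictLevel μ ⟨Node.mk a es₀ cs₀, es₀.length, some (s, Node.mk b ys (d :: ds))⟩
          (.one y') =
        ⟨.one (recompute (setFirst (Node.mk b ys (d :: ds)) y')).val, 2 * (es₀.length + 1) +
          (2 * (ys.length + 1) + 0 + 0)⟩ := by
      unfold evictLevel
      simp only [Node.entries_mk, List.drop_length]
      rfl
    rw [e]
    have hy2 := hy.2.1
    simp only [Node.arity_mk] at hy2
    refine ⟨Or.inr ⟨_, rfl, good_recompute (hset y' hy'), ?_⟩, by simp only; omega⟩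
    rw [toList_recompute]
    have := (List.Sublist.append_right hl (weaveE ys ds)).trans
      (l₃ := weave es₀ cs₀ ++ s :: (d.toList ++ weaveE ys ds))
      (by simpa using List.Sublist.append_right h2 (s :: (d.toList ++ weaveE ys ds)))
    simpa [neighborList, setFirst] using this

theorem evictLoop_root (μ : ℕ) (r : Node T S) (acc : List (Frame T S)) :
    evictLoop μ (.root r) acc = ⟨.root r, 0⟩ := by
  cases acc <;> rfl

end Evict

section EvictBelow

variable [LinearOrder T]

theorem descend_end {t : T} {x : Node T S} {nb : Option ((T × S) × Node T S)}
    {acc : List (Frame T S)}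
    (h : (∃ e ∈ x.entries, e.1 = t) ∨ x.children[countLE t x.entries]? = none) :
    descend t x nb acc = ⟨(⟨x, countLE t x.entries, nb⟩, acc), 3 + 2 * x.arity⟩ := by
  rw [descend]
  by_cases h1 : ∃ e ∈ x.entries, e.1 = t
  · simp only [if_pos h1]; rfl
  · simp only [if_neg h1]
    have h2 := h.resolve_left h1
    split
    · rfl
    · rename_i h3; rw [h2] at h3; cases h3

theorem descend_step {t : T} {x c : Node T S} {nb : Option ((T × S) × Node T S)}
    {acc : List (Frame T S)} (h1 : ¬ ∃ e ∈ x.entries, e.1 = t)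
    (h2 : x.children[countLE t x.entries]? = some c) :
    descend t x nb acc =
      ⟨(descend t c (childNeighbor x (countLE t x.entries) nb)
          (⟨x, countLE t x.entries, nb⟩ :: acc)).val,
        3 + 2 * x.arity + (descend t c (childNeighbor x (countLE t x.entries) nb)
          (⟨x, countLE t x.entries, nb⟩ :: acc)).time⟩ := by
  rw [descend]
  simp only [if_neg h1]
  split
  · rename_i h3; rw [h2] at h3; cases h3
  · rename_i d h3
    obtain rfl : c = d := by rw [h2] at h3; exact (Option.some.injEq _ _).mp h3
    rfl

variable [Monoid S]

/-- Search below `x` and evict up to the top, where `acc` holds the levels above `x`. -/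
def evictFrom (μ : ℕ) (t : T) (x : Node T S) (nb : Option ((T × S) × Node T S))
    (acc : List (Frame T S)) : Timed (Outcome T S) := do
  let b ← descend t x nb acc
  let o ← evictBottom μ b.1
  evictLoop μ o b.2

/-- Search and eviction loop are two passes in opposite directions. Carrying the levels above as
`acc` turns them into one recursion on height: everything below and including `x` amounts to some
fitting outcome `o`, after which only the loop over `acc` remains. -/
theorem evictFrom_spec {μ : ℕ} (hμ : 2 ≤ μ) (t : T) {h : ℕ} {x : Node T S}
    {nb : Option ((T × S) × Node T S)} (acc : List (Frame T S)) (hx : x.Balanced μ h)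
    (hx2 : x.arity ≤ 2 * μ) (hnb : ∀ p ∈ nb, Good μ h p.2) :
    ∃ o : Outcome T S, o.Fits μ h (x.toList ++ neighborList nb) nb ∧
      (evictFrom μ t x nb acc).val = (evictLoop μ o acc).val ∧
      (evictFrom μ t x nb acc).time ≤ 20 * μ * (h + 1) + (evictLoop μ o acc).time := by
  induction h generalizing x nb acc with
  | zero =>
    obtain ⟨i1, i2⟩ := evictBottom_spec hμ (fr := ⟨x, countLE t x.entries, nb⟩) hx hx2
      List.countP_le_length hnb
    refine ⟨_, i1, ?_, ?_⟩
    · rw [evictFrom, descend_end (Or.inr (by simp [balanced_zero.1 hx]))]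
      rfl
    · rw [evictFrom, descend_end (Or.inr (by simp [balanced_zero.1 hx]))]
      simp only [Timed.time_bind]
      omega
  | succ h ih =>
    by_cases hfull : (∃ e ∈ x.entries, e.1 = t) ∨ x.children[countLE t x.entries]? = none
    · obtain ⟨i1, i2⟩ := evictBottom_spec hμ (fr := ⟨x, countLE t x.entries, nb⟩) hx hx2
        List.countP_le_length hnb
      refine ⟨_, i1, ?_, ?_⟩
      · rw [evictFrom, descend_end hfull]
        rfl
      · rw [evictFrom, descend_end hfull]
        simp only [Timed.time_bind]
        nlinarith
    · push Not at hfull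
      obtain ⟨hs1, hs2⟩ := hfull
      have hs1' : ¬ ∃ e ∈ x.entries, e.1 = t := by push Not; exact hs1
      obtain ⟨c, hc⟩ := Option.ne_none_iff_exists'.1 hs2
      have hcnt : countLE t x.entries ≤ x.entries.length := List.countP_le_length
      have hstep : ∀ fr : Frame T S, fr = ⟨x, countLE t x.entries, nb⟩ →
          (evictFrom μ t x nb acc).val =
            (evictFrom μ t c (childNeighbor x (countLE t x.entries) nb) (fr :: acc)).val ∧
          (evictFrom μ t x nb acc).time = 3 + 2 * x.arity +
            (evictFrom μ t c (childNeighbor x (countLE t x.entries) nb) (fr :: acc)).time := by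
        rintro fr rfl
        rw [evictFrom, descend_step hs1' hc]
        refine ⟨rfl, ?_⟩
        simp only [Timed.time_bind, evictFrom]
        omega
      generalize countLE t x.entries = i at hc hcnt hstep
      obtain ⟨hs3, hs4⟩ := hstep _ rfl
      rw [hs3, hs4]
      have hb := balanced_succ.1 hx
      obtain ⟨hi, hci⟩ := List.getElem?_eq_some_iff.1 hc
      have hcg : Good μ h c := hb.2 c (hci ▸ List.getElem_mem hi)
      have hdrop : x.children.drop i = c :: x.children.drop (i + 1) := by
        rw [← hci]; exact List.drop_eq_getElem_cons hi
      -- continue from the outcome of the level of `c`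
      have key : ∀ (o' : Outcome T S), (∀ r, o' ≠ .root r) →
          ((evictLevel μ ⟨x, i, nb⟩ o').val.Fits μ (h + 1) (x.toList ++ neighborList nb) nb ∧
            (evictLevel μ ⟨x, i, nb⟩ o').time ≤ 2 + 10 * μ) →
          (evictFrom μ t c (childNeighbor x i nb) (⟨x, i, nb⟩ :: acc)).val =
            (evictLoop μ o' (⟨x, i, nb⟩ :: acc)).val →
          (evictFrom μ t c (childNeighbor x i nb) (⟨x, i, nb⟩ :: acc)).time ≤
            20 * μ * (h + 1) + (evictLoop μ o' (⟨x, i, nb⟩ :: acc)).time →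
          ∃ o : Outcome T S, o.Fits μ (h + 1) (x.toList ++ neighborList nb) nb ∧
            (evictFrom μ t c (childNeighbor x i nb) (⟨x, i, nb⟩ :: acc)).val =
              (evictLoop μ o acc).val ∧
            3 + 2 * x.arity +
              (evictFrom μ t c (childNeighbor x i nb) (⟨x, i, nb⟩ :: acc)).time ≤
              20 * μ * (h + 1 + 1) + (evictLoop μ o acc).time := by
        intro o' hr hf h1 h2
        have e : evictLoop μ o' (⟨x, i, nb⟩ :: acc) =
            ⟨(evictLoop μ (evictLevel μ ⟨x, i, nb⟩ o').val acc).val,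
              (evictLevel μ ⟨x, i, nb⟩ o').time +
              (evictLoop μ (evictLevel μ ⟨x, i, nb⟩ o').val acc).time⟩ := by
          cases o' with
          | root r => exact absurd rfl (hr r)
          | one y => rfl
          | two x s y => rfl
        rw [e] at h1 h2
        refine ⟨_, hf.1, h1, ?_⟩
        have := hf.2
        simp only at h2
        nlinarith
      have notRoot : ∀ {o' : Outcome T S} {l : List (T × S)} {p : (T × S) × Node T S},
          o'.Fits μ h l (some p) → ∀ r, o' ≠ .root r := by
        rintro o' l p (⟨_, _, _, rfl, _⟩ | ⟨_, rfl, _⟩) r <;> simp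
      -- An entry of `x` to the right of the chosen child gives a sibling as neighbor; otherwise the
      -- child is the last one and its neighbor comes from the neighbor of `x`.
      rcases hcnt.lt_or_eq with hlt | heq
      · have he : x.entries.drop i = x.entries[i] :: x.entries.drop (i + 1) :=
          List.drop_eq_getElem_cons hlt
        have hd : x.children.drop (i + 1) = x.children[i + 1] :: x.children.drop (i + 1 + 1) :=
          List.drop_eq_getElem_cons (by omega)
        generalize x.entries[i] = e at he
        have hdg : Good μ h x.children[i + 1] := hb.2 _ (List.getElem_mem _)
        generalize x.children[i + 1] = d at hd hdg
        have hcn : childNeighbor x i nb = some (e, d) := by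
          unfold childNeighbor
          simp only [he, hd]
        rw [hcn] at key ⊢
        obtain ⟨o', h1, h2, h3⟩ := ih (x := c) (nb := some (e, d)) (⟨x, i, nb⟩ :: acc)
          hcg.2.2 hcg.2.1 (fun p hp => by
            obtain rfl := (Option.some.injEq _ _).mp hp
            exact hdg)
        exact key o' (notRoot h1) (evictLevel_inner_spec hμ (fr := ⟨x, i, nb⟩) hx hx2 he
          (by rw [hdrop, hd]) h1 hnb) h2 h3
      · have he : x.entries.drop i = [] := by simp [heq]
        have hd : x.children.drop (i + 1) = [] := by simp [heq, hb.1]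
        match nb with
        | none =>
          have hcn : childNeighbor x i none = none := by
            unfold childNeighbor
            simp only [he, hd]
          rw [hcn] at key ⊢
          obtain ⟨o', h1, h2, h3⟩ := ih (x := c) (nb := none) (⟨x, i, none⟩ :: acc)
            hcg.2.2 hcg.2.1 (by simp)
          -- Without a neighbor the level below has already produced the new root, which the loop
          -- hands upwards unchanged.
          obtain ⟨r, rfl, ⟨h', hh, hr⟩, hl⟩ := h1
          rw [evictLoop_root] at h2 h3
          refine ⟨.root r, ⟨r, rfl, ⟨h', by omega, hr⟩, ?_⟩, by rw [evictLoop_root, h2], ?_⟩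
          · refine hl.trans ?_
            obtain ⟨a, es, cs⟩ := x
            have := (Balanced.drop hx hcnt a).2
            simp only [Node.entries_mk, Node.children_mk] at he hdrop hd this
            rw [he, hdrop, hd] at this
            simpa [neighborList] using this
          · rw [evictLoop_root]
            simp only at h3 ⊢
            nlinarith
        | some (s, y) =>
          have hy : Good μ (h + 1) y := hnb (s, y) rfl
          obtain ⟨d, ds, hds⟩ : ∃ d ds, y.children = d :: ds := by
            have := (balanced_succ.1 hy.2.2).1
            match hq : y.children with
            | [] => rw [hq] at this; simp at this
            | d :: ds => exact ⟨d, ds, rfl⟩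
          have hcn : childNeighbor x i (some (s, y)) = some (s, d) := by
            obtain ⟨b, ys, ds'⟩ := y
            simp only [Node.children_mk] at hds
            subst hds
            unfold childNeighbor
            simp only [he, hd]
          rw [hcn] at key ⊢
          have hdg : Good μ h d := (balanced_succ.1 hy.2.2).2 d (by simp [hds])
          obtain ⟨o', h1, h2, h3⟩ := ih (x := c) (nb := some (s, d)) (⟨x, i, some (s, y)⟩ :: acc)
            hcg.2.2 hcg.2.1 (fun p hp => by
              obtain rfl := (Option.some.injEq _ _).mp hp
              exact hdg)
          exact key o' (notRoot h1) (evictLevel_last_spec hμ (fr := ⟨x, i, some (s, y)⟩) hx hx2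
            heq (by rw [hdrop, hd]) rfl hy hds h1) h2 h3

theorem evictBelow_spec {μ : ℕ} (hμ : 2 ≤ μ) (t : T) {h : ℕ} {x : Node T S}
    {nb : Option ((T × S) × Node T S)} (hx : x.Balanced μ h)
    (hx2 : x.arity ≤ 2 * μ) (hnb : ∀ p ∈ nb, Good μ h p.2) :
    (evictBelow μ t x nb).val.Fits μ h (x.toList ++ neighborList nb) nb ∧
      (evictBelow μ t x nb).time ≤ 20 * μ * (h + 1) := by
  obtain ⟨o, h1, h2, h3⟩ := evictFrom_spec hμ t [] hx hx2 hnb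
  have e : evictLoop μ o [] = ⟨o, 0⟩ := by cases o <;> rfl
  rw [e] at h2 h3
  exact ⟨by subst h2; exact h1, h3⟩

end EvictBelow

/-! ### The repair loop -/

/-- The leftmost node of an outcome. -/
def Outcome.first : Outcome T S → Node T S
  | .two x _ _ => x
  | .one y => y
  | .root x => x

@[simp] theorem Outcome.first_two (x : Node T S) (s : T × S) (y : Node T S) :
    (Outcome.two x s y).first = x := rfl

@[simp] theorem Outcome.first_one (y : Node T S) : (Outcome.one y).first = y := rfl

/-- The quantitative point is the last clause: the parent keeps its arity or loses exactly one.
Hence a node that meets the minimum can underflow only if it was tight. -/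
theorem plug_spec {μ k : ℕ} {p : Node T S} (hp : Half μ (k + 1) p) (hne : p.entries ≠ []) :
    ∃ s y, firstNeighbor p = some (s, y) ∧ Good μ k y ∧
      ∀ (l : List (T × S)) (o : Outcome T S), o.Fits μ k (l ++ s :: y.toList) (some (s, y)) →
        (plug p o).Balanced μ (k + 1) ∧ (plug p o).toList.Sublist (l ++ tailList p) ∧
        (∃ cs, (plug p o).children = o.first :: cs) ∧ Good μ k o.first ∧
        (((plug p o).arity = p.arity ∧ ∃ x s y, o = .two x s y) ∨
          ((plug p o).arity + 1 = p.arity ∧ ∃ y, o = .one y)) := by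
  obtain ⟨a, es, cs⟩ := p
  obtain ⟨h1, h2⟩ := hp
  simp only [Node.children_mk, Node.entries_mk] at h1 h2 hne
  match es, cs with
  | [], _ => exact absurd rfl hne
  | _ :: _, [] => simp at h1
  | s :: es, y :: cs =>
    refine ⟨s, y, rfl, h2 y (by simp), fun l o ho => ?_⟩
    rcases ho with ⟨x', s', y', rfl, hx', hy', hl⟩ | ⟨y', rfl, hy', hl⟩
    · refine ⟨balanced_succ.2 ⟨by simpa [plug] using h1, fun z hz => ?_⟩, ?_, ⟨_, rfl⟩, hx',
        Or.inl ⟨rfl, _, _, _, rfl⟩⟩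
      · simp only [plug, Node.children_mk, List.mem_cons, List.drop_succ_cons,
          List.drop_zero] at hz
        rcases hz with rfl | rfl | hz
        · exact hx'
        · exact hy'
        · exact h2 z (by simp [hz])
      · simpa [plug, tailList] using List.Sublist.append_right hl (weaveE es cs)
    · refine ⟨balanced_succ.2 ⟨by simpa [plug] using h1, fun z hz => ?_⟩, ?_, ⟨_, rfl⟩, hy',
        Or.inr ⟨rfl, _, rfl⟩⟩
      · simp only [plug, Node.children_mk, List.mem_cons, List.drop_succ_cons,
          List.drop_zero] at hz
        rcases hz with rfl | hz
        · exact hy'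
        · exact h2 z (by simp [hz])
      · simpa [plug, tailList] using List.Sublist.append_right hl (weaveE es cs)

/-- The result is the root without its first child only, so it can be treated like any other
ancestor on the left spine. Its cost is linear in the height, hence affordable only when the
operation has come up to the root. -/
theorem completeRight_spec {μ k : ℕ} {f : FiBA T S} (hf : Shape μ f) (hk : f.left.length = k + 1) :
    Half μ (k + 1) (completeRight f).val ∧ (completeRight f).val.entries ≠ [] ∧
      (completeRight f).val.arity ≤ 2 * μ ∧
      tailList (completeRight f).val =
        tailList f.root ++ f.right.reverse.flatMap Node.toList ∧
      (completeRight f).time ≤ 1 + 2 * μ * (k + 2) := by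
  obtain ⟨left, root, right⟩ := f
  obtain ⟨h1, h2, h3, h4, h5⟩ := hf
  simp only at *
  rcases h5 with ⟨rfl, h5⟩ | ⟨k', h5, h6, h7⟩
  · simp at hk
  obtain rfl : k' = k := by omega
  have hsum := h3.arity_sum_le
  rw [← h1, hk] at hsum
  match right with
  | [] => rw [hk] at h1; simp at h1
  | r :: rs =>
    have hrs : rs.length = k' := by rw [hk] at h1; simpa using h1.symm
    have hR := (good_foldl_attachLast (μ := μ) (k := 0) (x := r) (ps := rs)).2
      ⟨⟨h3.1.1, h3.1.2, h3.2.1⟩, h3.2.2⟩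
    rw [zero_add, hrs] at hR
    set R := rs.foldl (fun c p => attachLast p c) r with hRdef
    have e : (completeRight ⟨left, root, r :: rs⟩) =
        ⟨attachLast root R, 1 + ((r :: rs).map Node.arity).sum + root.arity + 0⟩ := rfl
    rw [e]
    refine ⟨⟨by simpa [attachLast] using h6, fun c hc => ?_⟩, ?_, h4, ?_, ?_⟩
    · rcases List.mem_append.1 hc with hc | hc
      · exact h7 c hc
      · obtain rfl := List.mem_singleton.1 hc
        exact hR
    · intro h
      simp only [attachLast, Node.entries_mk] at h
      rw [h] at h6
      simp at h6
    · simp only [tailList, attachLast, Node.entries_mk, Node.children_mk, weaveE_concat R h6]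
      rw [hRdef, toList_foldl_attachLast r h3.2.2]
      simp
    · simp only
      linarith

theorem Outcome.Fits.ne_root {μ k : ℕ} {l : List (T × S)} {p : (T × S) × Node T S}
    {o : Outcome T S} (ho : o.Fits μ k l (some p)) (r : Node T S) : o ≠ .root r := by
  rcases ho with ⟨_, _, _, rfl, _⟩ | ⟨_, rfl, _⟩ <;> simp

section Repair

variable [Monoid S]

theorem rebalance_none {μ h : ℕ} (hμ : 2 ≤ μ) {x : Node T S} (hx : x.Balanced μ (h + 1))
    (hx2 : x.arity ≤ 2 * μ) :
    ∃ r, rebalance μ x none = ⟨.root r, 2⟩ ∧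
      ((r = x ∧ RootTree μ (h + 1) r) ∨ (x.children = [r] ∧ x.entries = [] ∧ RootTree μ h r)) := by
  obtain ⟨a, es, cs⟩ := x
  have hb := balanced_succ.1 hx
  simp only [Node.children_mk, Node.entries_mk] at hb
  match es, cs with
  | [], [] => simp at hb
  | [], [c] =>
    have hg := hb.2 c (by simp)
    exact ⟨c, rfl, Or.inr ⟨rfl, rfl, hg.2.2, hg.2.1, Or.inl (hμ.trans hg.1)⟩⟩
  | [], _ :: _ :: _ => simp at hb
  | _ :: _, [] => simp at hb
  | _ :: _, _ :: _ => exact ⟨_, rfl, Or.inl ⟨rfl, hx, hx2, Or.inl (by simp)⟩⟩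

theorem repairRoot_root {μ h : ℕ} (hμ : 2 ≤ μ) {p x : Node T S} (hp : p.arity ≤ 2 * μ)
    (hx : RootTree μ h x) :
    Shape μ (repairRoot μ p (.root x)).val ∧
      (repairRoot μ p (.root x)).val.window = x.toList ∧
      tightCount μ (repairRoot μ p (.root x)).val.left ≤ h ∧
      (repairRoot μ p (.root x)).time ≤ 4 * μ + 12 * μ * (h + 1) := by
  obtain ⟨h1, h2, -, h4, h5⟩ := makeRoot_spec hμ hx
  have e : repairRoot μ p (.root x) = ⟨(makeRoot x).val, 2 * p.arity + (makeRoot x).time⟩ := rfl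
  rw [e]
  refine ⟨h1, h2, ?_, ?_⟩
  · simp only [h4]; exact tightBelow_le μ h x
  · simp only; omega

/-- Whether the root stays or its single child takes over, the left spine consists at most of the
outcome's first node and the spine below it. -/
theorem repairRoot_spec {μ k : ℕ} (hμ : 2 ≤ μ) {p : Node T S} (hp : Half μ (k + 1) p)
    (hne : p.entries ≠ []) (hp2 : p.arity ≤ 2 * μ) {l : List (T × S)} {o : Outcome T S}
    (ho : o.Fits μ k (l ++ neighborList (firstNeighbor p)) (firstNeighbor p)) :
    Shape μ (repairRoot μ p o).val ∧
      (repairRoot μ p o).val.window.Sublist (l ++ tailList p) ∧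
      tightCount μ (repairRoot μ p o).val.left ≤ tight μ o.first + tightBelow μ k o.first ∧
      (repairRoot μ p o).time ≤ 20 * μ * (k + 2) := by
  obtain ⟨s, y, hs, hy, hplug⟩ := plug_spec hp hne
  rw [hs] at ho
  obtain ⟨h1, h2, ⟨cs, h3⟩, h4, h5⟩ := hplug l o ho
  have har : (plug p o).arity ≤ 2 * μ := by
    rcases h5 with ⟨h5, -⟩ | ⟨h5, -⟩ <;> omega
  obtain ⟨r, hr, hr2⟩ := rebalance_none hμ h1 har
  have e : repairRoot μ p o = ⟨(makeRoot r).val, 2 * p.arity + (2 + (makeRoot r).time)⟩ := by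
    unfold repairRoot
    rcases h5 with ⟨-, x, s, y, rfl⟩ | ⟨-, y, rfl⟩
    · simp only [hr]; rfl
    · simp only [hr]; rfl
  rw [e]
  rcases hr2 with ⟨rfl, hr2⟩ | ⟨hc, he, hr2⟩
  · obtain ⟨i1, i2, -, i4, i5⟩ := makeRoot_spec hμ hr2
    refine ⟨i1, by simpa only [i2] using h2, ?_, ?_⟩
    · simp only [i4]
      rw [tightBelow_cons μ k h3]
    · simp only
      nlinarith
  · obtain ⟨i1, i2, -, i4, i5⟩ := makeRoot_spec hμ hr2
    obtain rfl : r = o.first := by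
      rw [hc] at h3
      exact (List.cons.inj h3).1
    refine ⟨i1, ?_, ?_, ?_⟩
    · simp only [i2]
      rw [Node.toList_eq (plug p o), hc, he] at h2
      simpa using h2
    · simp only [i4]
      omega
    · simp only
      nlinarith

/-- The loop matches first on the outcome; excluding the root case gives one unfolding for both
others. -/
theorem repairLoop_eq (μ : ℕ) (f : FiBA T S) {o : Outcome T S} (ho : ∀ r, o ≠ .root r)
    (p : Node T S) (ps : List (Node T S)) :
    repairLoop μ f o p ps = (do
      Timed.tick (2 + 2 * p.arity)
      if μ ≤ (plug p o).arity then do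
        let l ← passDownLeft (parentAgg ps) (plug p o) ps
        pure { f with left := l }
      else match ps with
        | [] => do
          let r ← completeRight f
          let o' ← rebalance μ (plug p o) (firstNeighbor r)
          repairRoot μ r o'
        | q :: qs => do
          let o' ← rebalance μ (plug p o) (firstNeighbor q)
          repairLoop μ f o' q qs) := by
  cases o with
  | root r => exact absurd rfl (ho r)
  | one y => cases ps <;> rfl
  | two x s y => cases ps <;> rfl

/-- When the repair stops, the ancestors above stay untouched and keep their potential; the cost is
the pass down from this level. -/
theorem repairLoop_of_full {μ k : ℕ} (hμ : 2 ≤ μ) {f : FiBA T S} (hf : Shape μ f)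
    {o : Outcome T S} (ho : ∀ r, o ≠ .root r) {p c : Node T S} {ps cs : List (Node T S)}
    (hps : Spine μ (k + 1 + 1) ps) (hlen : k + 1 + (p :: ps).length = f.left.length)
    (hp : p.arity ≤ 2 * μ) (hb : Good μ (k + 1) (plug p o)) (hc : (plug p o).children = c :: cs) :
    Shape μ (repairLoop μ f o p ps).val ∧
      (repairLoop μ f o p ps).val.window = (plug p o).toList ++ ps.flatMap tailList ++
        (tailList f.root ++ f.right.reverse.flatMap Node.toList) ∧
      tightCount μ (repairLoop μ f o p ps).val.left =
        tight μ (plug p o) + (tight μ c + tightBelow μ k c) + tightCount μ ps ∧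
      (repairLoop μ f o p ps).time ≤ 5 * μ * (k + 3) := by
  obtain ⟨h1, h2, h3, h4, h5⟩ := passDownLeft_spec (parentAgg ps) hb hps
  have e : repairLoop μ f o p ps =
      ⟨{ f with left := (passDownLeft (parentAgg ps) (plug p o) ps).val },
        2 + 2 * p.arity + ((passDownLeft (parentAgg ps) (plug p o) ps).time + 0)⟩ := by
    rw [repairLoop_eq μ f ho]
    simp only [if_pos hb.1]
    rfl
  have hs : Shape μ (repairLoop μ f o p ps).val := by
    rw [e]
    have hl : (passDownLeft (parentAgg ps) (plug p o) ps).val.length = f.left.length := by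
      rw [h2, ← hlen]; simp; omega
    refine ⟨hl.trans hf.spines, h1, hf.right, hf.root_max, ?_⟩
    rcases hf.root with ⟨h6, -⟩ | ⟨k', h6, h7⟩
    · rw [h6] at hlen; simp at hlen
    · exact Or.inr ⟨k', hl.trans h6, h7⟩
  refine ⟨hs, ?_, ?_, ?_⟩
  · rw [hs.window_eq, e]
    simp only [h3, List.append_assoc]
  · rw [e]
    simp only [h4]
    rw [tightBelow_cons μ k hc]
  · rw [e]
    simp only
    nlinarith

/-- Amortized cost with $k$ the height at which the loop starts. The term $30\mu(k+3)$ covers the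
final pass down, or the work at the root, from the current level. Each further iteration raises it
by $30\mu$, and that is paid from the potential of the tight node just merged. -/
theorem repairLoop_spec {μ : ℕ} (hμ : 2 ≤ μ) {f : FiBA T S} (hf : Shape μ f) {k : ℕ}
    {o : Outcome T S} {p : Node T S} {ps : List (Node T S)} {l : List (T × S)}
    (hps : Spine μ (k + 1) (p :: ps)) (hlen : k + 1 + (p :: ps).length = f.left.length)
    (ho : o.Fits μ k (l ++ neighborList (firstNeighbor p)) (firstNeighbor p)) :
    Shape μ (repairLoop μ f o p ps).val ∧
      (repairLoop μ f o p ps).val.window.Sublist (l ++ (p :: ps).flatMap tailList ++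
        (tailList f.root ++ f.right.reverse.flatMap Node.toList)) ∧
      (repairLoop μ f o p ps).time + 50 * μ * tightCount μ (repairLoop μ f o p ps).val.left ≤
        50 * μ * (tight μ o.first + tightBelow μ k o.first + tightCount μ (p :: ps)) +
          30 * μ * (k + 3) := by
  induction ps generalizing k o p l with
  | nil =>
    obtain ⟨⟨hp1, hp2⟩, hp3, hp4⟩ := hps
    have hne : p.entries ≠ [] := by
      intro h; rw [Node.arity, h] at hp1; simp at hp1; omega
    obtain ⟨s, y, hs, hy, hplug⟩ := plug_spec hp3 hne
    rw [hs] at ho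
    obtain ⟨h1, h2, ⟨cs, h3⟩, h4, h5⟩ := hplug l o ho
    have har : (plug p o).arity ≤ 2 * μ := by
      rcases h5 with ⟨h5, -⟩ | ⟨h5, -⟩ <;> omega
    by_cases hfull : μ ≤ (plug p o).arity
    · obtain ⟨i1, i2, i3, i4⟩ := repairLoop_of_full hμ hf ho.ne_root hp4 hlen hp2
        ⟨hfull, har, h1⟩ h3
      refine ⟨i1, ?_, ?_⟩
      · rw [i2]
        simpa using List.Sublist.append_right h2 _
      · rw [i3]
        have := Nat.mul_le_mul_left (50 * μ) (tight_le_one μ (plug p o))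
        simp only [tightCount_cons μ p, tightCount_nil]
        nlinarith
    -- The node had arity at least $\mu$ and lost at most one entry, so underflow forces equality.
    · have hpar : p.arity = μ := by
        rcases h5 with ⟨h5, -⟩ | ⟨h5, -⟩ <;> omega
      have hptight : tight μ p = 1 := if_pos hpar
      have hlen' : f.left.length = k + 1 + 1 := by rw [← hlen]; simp
      obtain ⟨c1, c2, c3, c4, c5⟩ := completeRight_spec hf hlen'
      obtain ⟨s', y', hs', hy', -⟩ := plug_spec c1 c2
      have hnb : ∀ q ∈ firstNeighbor (completeRight f).val, Good μ (k + 1) q.2 := by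
        rw [hs']
        intro q hq
        obtain rfl := (Option.some.injEq _ _).mp hq
        exact hy'
      obtain ⟨r1, r2⟩ := rebalance_spec hμ h1 har hnb
      obtain ⟨q1, q2, q3, q4⟩ := repairRoot_spec hμ c1 c2 c3 r1
      have hfirst : ∃ cs', (rebalance μ (plug p o)
          (firstNeighbor (completeRight f).val)).val.first.children = o.first :: cs' := by
        have ht := rebalance_tight (μ := μ) (p := (s', y')) h3 (by omega) hy'
        rw [hs'] at r1 ⊢
        rcases r1 with ⟨x, s, y, e, -⟩ | ⟨y, e, -⟩
        · rw [e]; exact ht.1 _ _ _ e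
        · rw [e]; exact (ht.2 _ e).2
      obtain ⟨cs', hfirst⟩ := hfirst
      rw [tightBelow_cons μ k hfirst] at q3
      have e : repairLoop μ f o p [] = ⟨(repairRoot μ (completeRight f).val
            (rebalance μ (plug p o) (firstNeighbor (completeRight f).val)).val).val,
          2 + 2 * p.arity + ((completeRight f).time +
            ((rebalance μ (plug p o) (firstNeighbor (completeRight f).val)).time +
            (repairRoot μ (completeRight f).val
            (rebalance μ (plug p o) (firstNeighbor (completeRight f).val)).val).time))⟩ := by
        rw [repairLoop_eq μ f ho.ne_root]
        simp only [if_neg hfull]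
        rfl
      rw [e]
      refine ⟨q1, ?_, ?_⟩
      · refine q2.trans ?_
        rw [c4]
        simpa using List.Sublist.append_right h2 _
      · have ht := tight_le_one μ (rebalance μ (plug p o)
          (firstNeighbor (completeRight f).val)).val.first
        have := Nat.mul_le_mul_left (50 * μ) (q3.trans (Nat.add_le_add_right ht _))
        simp only [tightCount_cons μ p, hptight, tightCount_nil]
        nlinarith
  | cons q qs ih =>
    obtain ⟨⟨hp1, hp2⟩, hp3, hp4⟩ := hps
    have hne : p.entries ≠ [] := by
      intro h; rw [Node.arity, h] at hp1; simp at hp1; omega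
    obtain ⟨s, y, hs, hy, hplug⟩ := plug_spec hp3 hne
    rw [hs] at ho
    obtain ⟨h1, h2, ⟨cs, h3⟩, h4, h5⟩ := hplug l o ho
    have har : (plug p o).arity ≤ 2 * μ := by
      rcases h5 with ⟨h5, -⟩ | ⟨h5, -⟩ <;> omega
    have hsub : ((plug p o).toList ++ (q :: qs).flatMap tailList ++
        (tailList f.root ++ f.right.reverse.flatMap Node.toList)).Sublist
        (l ++ (p :: q :: qs).flatMap tailList ++
        (tailList f.root ++ f.right.reverse.flatMap Node.toList)) := by
      rw [List.flatMap_cons (x := p), ← List.append_assoc l]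
      exact List.Sublist.append_right (List.Sublist.append_right h2 _) _
    by_cases hfull : μ ≤ (plug p o).arity
    · obtain ⟨i1, i2, i3, i4⟩ := repairLoop_of_full hμ hf ho.ne_root hp4 hlen hp2
        ⟨hfull, har, h1⟩ h3
      refine ⟨i1, ?_, ?_⟩
      · rw [i2]
        exact hsub
      · rw [i3]
        have := Nat.mul_le_mul_left (50 * μ) (tight_le_one μ (plug p o))
        rw [tightCount_cons μ p]
        nlinarith
    · have hpar : p.arity = μ := by
        rcases h5 with ⟨h5, -⟩ | ⟨h5, -⟩ <;> omega
      have hptight : tight μ p = 1 := if_pos hpar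
      obtain ⟨⟨hq1, hq2⟩, hq3, hq4⟩ := id hp4
      have hqne : q.entries ≠ [] := by
        intro h; rw [Node.arity, h] at hq1; simp at hq1; omega
      obtain ⟨s', y', hs', hy', hplug'⟩ := plug_spec hq3 hqne
      have hnb : ∀ z ∈ firstNeighbor q, Good μ (k + 1) z.2 := by
        rw [hs']
        intro z hz
        obtain rfl := (Option.some.injEq _ _).mp hz
        exact hy'
      obtain ⟨r1, r2⟩ := rebalance_spec hμ h1 har hnb
      have ht := rebalance_tight (μ := μ) (p := (s', y')) h3 (by omega) hy'
      rw [← hs'] at ht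
      have hlen' : k + 1 + 1 + (q :: qs).length = f.left.length := by
        rw [← hlen]; simp; omega
      have e : repairLoop μ f o p (q :: qs) =
          ⟨(repairLoop μ f (rebalance μ (plug p o) (firstNeighbor q)).val q qs).val,
          2 + 2 * p.arity + ((rebalance μ (plug p o) (firstNeighbor q)).time +
            (repairLoop μ f (rebalance μ (plug p o) (firstNeighbor q)).val q qs).time)⟩ := by
        rw [repairLoop_eq μ f ho.ne_root]
        simp only [if_neg hfull]
        rfl
      rw [e]
      have r1' : (rebalance μ (plug p o) (firstNeighbor q)).val.Fits μ (k + 1)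
          ((plug p o).toList ++ s' :: y'.toList) (some (s', y')) :=
        r1.mono (by rw [hs']; exact List.Sublist.refl _) (by rw [hs'])
      -- A batch move ends the loop at `q`; a merge continues it.
      rcases id r1' with ⟨x', s'', y'', eo, hx', hy'', hl⟩ | ⟨y'', eo, hy'', hl⟩
      · obtain ⟨cs', hcs'⟩ := ht.1 _ _ _ eo
        obtain ⟨j1, j2, ⟨ds, j3⟩, j4, j5⟩ := hplug' _ _ r1'
        rw [eo] at j1 j2 j3 j4 j5 ⊢
        have j6 : (plug q (.two x' s'' y'')).arity = q.arity := by
          rcases j5 with ⟨j5, -⟩ | ⟨-, z, hz⟩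
          · exact j5
          · cases hz
        obtain ⟨i1, i2, i3, i4⟩ := repairLoop_of_full hμ hf (o := .two x' s'' y'') (by simp) hq4
          hlen' hq2 ⟨by omega, by omega, j1⟩ j3
        refine ⟨i1, ?_, ?_⟩
        · simp only [i2]
          refine List.Sublist.trans ?_ hsub
          rw [List.flatMap_cons, ← List.append_assoc (plug p o).toList]
          exact List.Sublist.append_right (List.Sublist.append_right j2 _) _
        · simp only [i3, Outcome.first_two]
          -- The moved batch only exchanges the separator in `q`. The refilled node may be tight
          -- again, but it takes the place of the tight `p`, so the potential does not grow and this
          -- last step is charged to $k$.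
          have e1 : tight μ (plug q (.two x' s'' y'')) = tight μ q := by
            unfold tight; rw [j6]
          rw [e1, tightBelow_cons μ k hcs', tightCount_cons μ p, tightCount_cons μ q, hptight]
          have := Nat.mul_le_mul_left (50 * μ) (tight_le_one μ x')
          nlinarith
      · obtain ⟨ht0, cs', hcs'⟩ := ht.2 _ eo
        obtain ⟨i1, i2, i3⟩ := ih hp4 hlen' r1
        refine ⟨i1, i2.trans hsub, ?_⟩
        -- Accounting: the tight `p` releases $50\mu$, the merged node is not tight, this iteration
        -- costs at most $12\mu$, and the induction hypothesis at height $k+1$ asks for $30\mu$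
        -- more.
        rw [eo] at i3 ⊢
        simp only [Outcome.first_one] at i3
        rw [tightBelow_cons μ k hcs', ht0] at i3
        simp only
        rw [tightCount_cons μ p, hptight]
        nlinarith

end Repair

/-! ### The search along the spines -/

section Search

variable [LinearOrder T]

/-- The time bound telescopes over the levels climbed. The lower bound on evicted entries is carried
along because each step up certifies that the subtree left behind is evicted completely. -/
theorem climbLeft_spec {μ : ℕ} (hμ : 2 ≤ μ) (t : T) (root : Node T S) {k : ℕ} {x : Node T S}
    {ps : List (Node T S)} (hx : Good μ k x) (hps : Spine μ (k + 1) ps)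
    (hsort : (x.toList ++ ps.flatMap tailList).Pairwise fun a b => a.1 < b.1)
    (hcnt : 2 ^ k ≤ (x.toList.countP fun e => e.1 ≤ t) + 1) :
    ∃ k' x' ps', ((climbLeft t root x ps).val = (x', some ps') ∨
        ((climbLeft t root x ps).val = (x', none) ∧ ps' = [])) ∧
      (climbLeft t root x ps).time + 2 * k ≤ 2 * (k' + 1) ∧
      Good μ k' x' ∧ Spine μ (k' + 1) ps' ∧
      2 ^ k' ≤ (x'.toList.countP fun e => e.1 ≤ t) + 1 ∧
      x'.toList ++ ps'.flatMap tailList = x.toList ++ ps.flatMap tailList ∧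
      k' + ps'.length = k + ps.length ∧ tightCount μ ps' ≤ tightCount μ ps := by
  induction ps generalizing k x with
  | nil =>
    refine ⟨k, x, [], ?_, ?_, hx, hps, hcnt, rfl, rfl, le_rfl⟩
    · simp only [climbLeft, Timed.val_bind]
      split_ifs
      · exact Or.inl rfl
      · exact Or.inr ⟨rfl, trivial⟩
    · simp only [climbLeft, Timed.time_bind]
      split_ifs <;> simp <;> omega
  | cons p ps ih =>
    by_cases hb : beforeFirst t p.entries
    · have e : climbLeft t root x (p :: ps) = ⟨(x, some (p :: ps)), 2 + 0⟩ := by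
        simp only [climbLeft, if_pos hb]; rfl
      refine ⟨k, x, p :: ps, Or.inl (by rw [e]), by rw [e]; simp only; omega, hx, hps, hcnt, rfl,
        rfl, le_rfl⟩
    · have e : climbLeft t root x (p :: ps) =
          ⟨(climbLeft t root (attachFirst p x) ps).val,
            2 + (climbLeft t root (attachFirst p x) ps).time⟩ := by
        simp only [climbLeft, if_neg hb]; rfl
      obtain ⟨hp1, hp2, hp3⟩ := hps
      obtain ⟨e₀, es, hes, het⟩ : ∃ e₀ es, p.entries = e₀ :: es ∧ e₀.1 ≤ t := by
        cases hpe : p.entries with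
        | nil => exact absurd (by simp [beforeFirst, hpe]) hb
        | cons e₀ es =>
          refine ⟨e₀, es, rfl, ?_⟩
          by_contra hlt
          exact hb (by simpa [beforeFirst, hpe] using hlt)
      have htail : tailList p = e₀ :: weave es p.children := by simp [tailList, hes]
      have hlen := hx.length_toList hμ
      -- The first entry of `p` is at most $t$ and exceeds everything in its first child.
      have hall : (x.toList.countP fun e => e.1 ≤ t) = x.toList.length := by
        rw [List.countP_eq_length]
        intro z hz
        have := (List.pairwise_append.1 hsort).2.2 z hz e₀ (by simp [htail])
        simpa using this.le.trans het
      have hcnt' : 2 ^ (k + 1) ≤ ((attachFirst p x).toList.countP fun e => e.1 ≤ t) + 1 := by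
        rw [toList_attachFirst, List.countP_append, hall]
        omega
      obtain ⟨k', x', ps', h1, h2, h3, h4, h5, h6, h7, h8⟩ := ih (x := attachFirst p x)
        ⟨hp1.1, hp1.2, good_attachFirst hx hp2⟩ hp3
        (by simpa [toList_attachFirst] using hsort) hcnt'
      rw [e]
      refine ⟨k', x', ps', h1, by simp only; omega, h3, h4, h5, ?_, ?_, ?_⟩
      · rw [h6, toList_attachFirst]; simp
      · rw [h7]; simp; omega
      · rw [tightCount_cons]; omega

theorem climbRight_spec {μ : ℕ} (hμ : 2 ≤ μ) (t : T) {k : ℕ} {x : Node T S}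
    {ps : List (Node T S)} (hx : Good μ k x) (hps : Spine μ (k + 1) ps) :
    ∃ k' ≤ k + ps.length, Good μ k' (climbRight t x ps).val ∧
      (climbRight t x ps).val.toList.Sublist (ps.reverse.flatMap Node.toList ++ x.toList) ∧
      (climbRight t x ps).time ≤ (2 + 2 * μ) * (ps.length + 1) := by
  induction ps generalizing k x with
  | nil =>
    refine ⟨k, le_rfl, hx, by simp [climbRight], ?_⟩
    simp [climbRight]
    omega
  | cons p ps ih =>
    obtain ⟨hp1, hp2, hp3⟩ := hps
    by_cases hb : afterLast t p.entries
    · have e : climbRight t x (p :: ps) = ⟨x, 2 + p.arity + 0⟩ := by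
        simp only [climbRight, if_pos hb]; rfl
      rw [e]
      refine ⟨k, by omega, hx, List.sublist_append_right _ _, ?_⟩
      simp only
      nlinarith
    · have e : climbRight t x (p :: ps) = ⟨(climbRight t (attachLast p x) ps).val,
          2 + p.arity + (climbRight t (attachLast p x) ps).time⟩ := by
        simp only [climbRight, if_neg hb]; rfl
      obtain ⟨k', h1, h2, h3, h4⟩ := ih (x := attachLast p x)
        ⟨hp1.1, hp1.2, good_attachLast hx hp2⟩ hp3
      rw [e]
      refine ⟨k', by simp; omega, h2, ?_, ?_⟩
      · simpa [toList_attachLast hp2.1] using h3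
      · simp only [List.length_cons]
        nlinarith

end Search

/-! ### The whole eviction -/

/-- The level $k$ measures the work not paid by potential and serves both bounds: it is at most the
height, and $2^k$ is controlled by the number of evicted entries. The factor 2 covers the cases in
which the climb reaches the root, where one level more than the certified subtree is charged. -/
theorem bulkEvict_spec [LinearOrder T] [Monoid S] {μ : ℕ} (hμ : 2 ≤ μ) {f : FiBA T S}
    (hf : Shape μ f) (hsort : f.window.Pairwise fun a b => a.1 < b.1) (t : T) :
    Shape μ (bulkEvict μ f t).val ∧ (bulkEvict μ f t).val.window.Sublist f.window ∧
      ∃ k ≤ f.left.length, 2 ^ k ≤ 2 * (evictCount f t + 1) ∧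
        (bulkEvict μ f t).time + 50 * μ * tightCount μ (bulkEvict μ f t).val.left ≤
          50 * μ * tightCount μ f.left + 200 * μ * (k + 1) := by
  obtain ⟨left, root, right⟩ := f
  have hw := hf.window_eq
  have hnonneg := Nat.zero_le (50 * μ * tightCount μ left)
  have hspines := hf.spines
  simp only at hw hspines
  match left, right with
  | [], _ :: _ => simp at hspines
  | _ :: _, [] => simp at hspines
  | [], [] =>
    have hroot : root.children = [] := by
      rcases hf.root with ⟨-, h⟩ | ⟨k, h, -⟩
      · exact h
      · simp at h
    obtain ⟨h1, h2⟩ := evictBelow_spec hμ t (h := 0) (x := root) (nb := none)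
      (balanced_zero.2 hroot) hf.root_max (by simp)
    obtain ⟨r, hr, ⟨h', hh', hrt⟩, hl⟩ := h1
    obtain ⟨i1, i2, i3, i4⟩ := repairRoot_root hμ hf.root_max hrt
    obtain rfl : h' = 0 := by omega
    have e : bulkEvict μ ⟨[], root, []⟩ t = ⟨(repairRoot μ root (evictBelow μ t root none).val).val,
        3 + ((evictBelow μ t root none).time +
          (repairRoot μ root (evictBelow μ t root none).val).time)⟩ := rfl
    rw [e, hr]
    refine ⟨i1, ?_, 0, by simp, by simp; omega, ?_⟩
    · simp only at *
      rw [i2, hw]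
      simpa [neighborList, leaf_tailList hroot] using hl
    · simp only [Nat.le_zero] at i3
      simp only [i3]
      simp only at i4
      omega
  | l :: ls, r :: rs =>
    have hls : rs.length = ls.length := by simpa using hspines.symm
    have hl0 := hf.left
    have hr0 := hf.right
    simp only [List.length_cons]
    have hlg : Good μ 0 l := ⟨hl0.1.1, hl0.1.2, hl0.2.1⟩
    have hltail : tailList l = l.toList := leaf_tailList hl0.2.1
    obtain ⟨k₀, hk₀, hrc, hrg⟩ := hf.root.resolve_left (by simp)
    have hrlen : root.entries ≠ [] := by
      intro h
      simp only at hrc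
      rw [h] at hrc
      simp at hrc
    have hmul := Nat.mul_le_mul_right ls.length hμ
    by_cases hafter : afterLast t root.entries
    · obtain ⟨k', hk', c1, c2, c3⟩ := climbRight_spec hμ t (k := 0) (x := r) (ps := rs)
        ⟨hr0.1.1, hr0.1.2, hr0.2.1⟩ hr0.2.2
      obtain ⟨h1, h2⟩ := evictBelow_spec hμ t (nb := none) c1.2.2 c1.2.1 (by simp)
      obtain ⟨x, hx, ⟨h', hh', hxt⟩, hxl⟩ := h1
      obtain ⟨i1, i2, i3, i4⟩ := repairRoot_root hμ c1.2.1 hxt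
      have e : bulkEvict μ ⟨l :: ls, root, r :: rs⟩ t =
          ⟨(repairRoot μ (climbRight t r rs).val
              (evictBelow μ t (climbRight t r rs).val none).val).val,
            3 + ((climbRight t r rs).time +
              ((evictBelow μ t (climbRight t r rs).val none).time +
              (repairRoot μ (climbRight t r rs).val
              (evictBelow μ t (climbRight t r rs).val none).val).time))⟩ := by
        simp only [bulkEvict, if_pos hafter]
        rfl
      rw [e, hx]
      -- All of the left subtree is evicted, so the full height can be charged to $m$.
      refine ⟨i1, ?_, ls.length + 1, le_rfl, ?_, ?_⟩
      · simp only [i2]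
        simp only [neighborList, List.append_nil] at hxl
        refine hxl.trans (c2.trans ?_)
        rw [hw]
        simp only [List.reverse_cons, List.flatMap_append, List.flatMap_cons, List.flatMap_nil,
          List.append_nil]
        exact List.sublist_append_right _ _
      · have hlen := hf.length_window hμ
        simp only [List.length_cons] at hlen
        have hall : ((l :: ls).flatMap tailList).countP (fun e => e.1 ≤ t) =
            ((l :: ls).flatMap tailList).length := by
          rw [List.countP_eq_length]
          intro z hz
          rw [hw, List.append_assoc] at hsort
          have hlast : root.entries.getLast hrlen ∈ tailList root :=
            (entries_sublist_weaveE _ _).subset (List.getLast_mem hrlen)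
          have h1 := (List.pairwise_append.1 hsort).2.2 z hz _ (List.mem_append_left _ hlast)
          have h2 := hafter _ (List.getLast?_eq_some_getLast hrlen)
          simpa using (h1.trans h2).le
        rw [evictCount, hw, List.countP_append, List.countP_append, hall]
        omega
      · simp only
        have e1 : h' ≤ ls.length := by omega
        have e2 := Nat.mul_le_mul_left (50 * μ) (i3.trans e1)
        have e3 := Nat.mul_le_mul_left (12 * μ) e1
        have e4 : 20 * μ * k' ≤ 20 * μ * ls.length :=
          Nat.mul_le_mul_left _ (by omega)
        rw [hls] at c3
        linarith
    · have hsort' : (l.toList ++ ls.flatMap tailList).Pairwise fun a b => a.1 < b.1 := by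
        rw [hw, List.append_assoc] at hsort
        have := (List.pairwise_append.1 hsort).1
        simpa [hltail] using this
      obtain ⟨k, x, ps, c1, c2, c3, c4, c5, c6, c7, c8⟩ := climbLeft_spec hμ t root hlg hl0.2.2
        hsort' (by simp)
      have hcount : (x.toList.countP fun e => e.1 ≤ t) ≤
          evictCount ⟨l :: ls, root, r :: rs⟩ t := by
        rw [evictCount, hw, List.flatMap_cons, hltail, ← c6, List.countP_append,
          List.countP_append, List.countP_append]
        omega
      have hw' : (⟨l :: ls, root, r :: rs⟩ : FiBA T S).window =
          x.toList ++ ps.flatMap tailList ++ (tailList root ++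
            (r :: rs).reverse.flatMap Node.toList) := by
        rw [hw, List.flatMap_cons, hltail, ← c6, List.append_assoc _ (tailList root)]
      obtain ⟨p1, p2, p3, p4, p5⟩ := completeRight_spec (k := ls.length) hf rfl
      have p4' : tailList (completeRight ⟨l :: ls, root, r :: rs⟩).val =
          tailList root ++ (r :: rs).reverse.flatMap Node.toList := p4
      have hmulk := Nat.mul_le_mul_right k hμ
      set F : FiBA T S := ⟨l :: ls, root, r :: rs⟩ with hF
      rcases c1 with c1 | ⟨c1, rfl⟩
      · match ps with
        | [] =>
          obtain rfl : k = ls.length := by simpa using c7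
          obtain ⟨s, y, hs, hy, -⟩ := plug_spec p1 p2
          obtain ⟨h1, h2⟩ := evictBelow_spec hμ t (nb := firstNeighbor (completeRight F).val)
            c3.2.2 c3.2.1 (by
              rw [hs]
              intro q hq
              obtain rfl := (Option.some.injEq _ _).mp hq
              exact hy)
          obtain ⟨i1, i2, i3, i4⟩ := repairRoot_spec hμ p1 p2 p3 h1
          have e : bulkEvict μ F t =
              ⟨(repairRoot μ (completeRight F).val (evictBelow μ t x
                  (firstNeighbor (completeRight F).val)).val).val,
                3 + ((climbLeft t root l ls).time + ((completeRight F).time +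
                ((evictBelow μ t x (firstNeighbor (completeRight F).val)).time +
                (repairRoot μ (completeRight F).val (evictBelow μ t x
                  (firstNeighbor (completeRight F).val)).val).time)))⟩ := by
            simp only [bulkEvict, hF, if_neg hafter]
            simp only [bind, c1]
            rfl
          rw [e]
          -- The climb ended at the first child of the root; its height is `ls.length`, and the root
          -- level adds one.
          refine ⟨i1, ?_, ls.length + 1, le_rfl, ?_, ?_⟩
          · rw [hw']
            simpa [p4'] using i2
          · rw [pow_succ]
            omega
          · simp only
            have e1 := tight_le_one μ (evictBelow μ t x (firstNeighbor (completeRight F).val)).val.first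
            have e2 := tightBelow_le μ ls.length
              (evictBelow μ t x (firstNeighbor (completeRight F).val)).val.first
            have e3 := Nat.mul_le_mul_left (50 * μ) (i3.trans (Nat.add_le_add e1 e2))
            linarith
        | p :: ps =>
          obtain ⟨⟨hp1, hp2⟩, hp3, hp4⟩ := id c4
          have hne : p.entries ≠ [] := by
            intro h; rw [Node.arity, h] at hp1; simp at hp1; omega
          obtain ⟨s, y, hs, hy, -⟩ := plug_spec hp3 hne
          obtain ⟨h1, h2⟩ := evictBelow_spec hμ t (nb := firstNeighbor p)
            c3.2.2 c3.2.1 (by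
              rw [hs]
              intro q hq
              obtain rfl := (Option.some.injEq _ _).mp hq
              exact hy)
          obtain ⟨i1, i2, i3⟩ := repairLoop_spec hμ hf c4 (by
            simp only [hF, List.length_cons] at c7 ⊢; omega) h1
          have e : bulkEvict μ F t =
              ⟨(repairLoop μ F (evictBelow μ t x (firstNeighbor p)).val p ps).val,
                3 + ((climbLeft t root l ls).time +
                ((evictBelow μ t x (firstNeighbor p)).time +
                (repairLoop μ F (evictBelow μ t x (firstNeighbor p)).val p ps).time))⟩ := by
            simp only [bulkEvict, hF, if_neg hafter]
            simp only [bind, c1]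
            rfl
          rw [e]
          -- The boundary stops below the root. The new spine part of height `k` has at most $k+1$
          -- tight nodes, and the rest of the old spine counts with its old potential.
          refine ⟨i1, ?_, k, ?_, ?_, ?_⟩
          · rw [hw']
            exact i2
          · simp only [List.length_cons] at c7
            omega
          · omega
          · simp only
            have e1 := tight_le_one μ (evictBelow μ t x (firstNeighbor p)).val.first
            have e2 := tightBelow_le μ k (evictBelow μ t x (firstNeighbor p)).val.first
            have e3 : tightCount μ (p :: ps) ≤ tightCount μ (l :: ls) := by
              rw [tightCount_cons μ l]; omega
            have e4 := Nat.mul_le_mul_left (50 * μ)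
              (Nat.add_le_add (Nat.add_le_add e1 e2) e3)
            linarith
      · obtain rfl : k = ls.length := by simpa using c7
        have hb := good_attachFirst c3 p1
        obtain ⟨h1, h2⟩ := evictBelow_spec hμ t (nb := none) hb p3 (by simp)
        obtain ⟨z, hz, ⟨h', hh', hzt⟩, hzl⟩ := h1
        obtain ⟨i1, i2, i3, i4⟩ := repairRoot_root hμ p3 hzt
        have e : bulkEvict μ F t =
            ⟨(repairRoot μ (completeRight F).val (evictBelow μ t
                (attachFirst (completeRight F).val x) none).val).val,
              3 + ((climbLeft t root l ls).time + ((completeRight F).time +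
              ((evictBelow μ t (attachFirst (completeRight F).val x) none).time +
              (repairRoot μ (completeRight F).val (evictBelow μ t
                (attachFirst (completeRight F).val x) none).val).time)))⟩ := by
          simp only [bulkEvict, hF, if_neg hafter]
          simp only [bind, c1]
          rfl
        rw [e, hz]
        refine ⟨i1, ?_, ls.length + 1, le_rfl, ?_, ?_⟩
        · rw [hw']
          simp only [i2]
          simpa [toList_attachFirst, neighborList, p4'] using hzl
        · rw [pow_succ]
          omega
        · simp only
          have e2 := Nat.mul_le_mul_left (50 * μ) (i3.trans hh')
          have e3 := Nat.mul_le_mul_left (12 * μ) hh'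
          linarith

/-! ### Bulk insertion -/

/-- Timestamps increase strictly. -/
def Increasing [LinearOrder T] (l : List (T × S)) : Prop := l.Pairwise fun a b => a.1 < b.1

section Interleave

variable [LinearOrder T] [Monoid S]

theorem forall_mem_interleave {P : T → Prop} {as bs : List (T × S)} (ha : ∀ a ∈ as, P a.1)
    (hb : ∀ b ∈ bs, P b.1) : ∀ e ∈ interleave as bs, P e.1 := by
  fun_induction interleave as bs with
  | case1 => exact hb
  | case2 => exact ha
  | case3 e es b bs h ih =>
    intro z hz
    rcases List.mem_cons.1 hz with rfl | hz
    · exact ha _ (by simp)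
    · exact ih (fun a h => ha a (List.mem_cons_of_mem _ h)) hb z hz
  | case4 e es b bs h h' ih =>
    intro z hz
    rcases List.mem_cons.1 hz with rfl | hz
    · exact hb _ (by simp)
    · exact ih ha (fun a h => hb a (List.mem_cons_of_mem _ h)) z hz
  | case5 e es b bs h h' ih =>
    intro z hz
    rcases List.mem_cons.1 hz with rfl | hz
    · exact ha e (by simp)
    · exact ih (fun a h => ha a (List.mem_cons_of_mem _ h))
        (fun a h => hb a (List.mem_cons_of_mem _ h)) z hz

theorem increasing_interleave {as bs : List (T × S)} (ha : Increasing as) (hb : Increasing bs) :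
    Increasing (interleave as bs) := by
  unfold Increasing at *
  fun_induction interleave as bs with
  | case1 => exact hb
  | case2 => exact ha
  | case3 e es b bs h ih =>
    rw [List.pairwise_cons] at ha ⊢
    refine ⟨forall_mem_interleave ha.1 ?_, ih ha.2 hb⟩
    intro z hz
    rcases List.mem_cons.1 hz with rfl | hz
    · exact h
    · exact h.trans ((List.pairwise_cons.1 hb).1 z hz)
  | case4 e es b bs h h' ih =>
    rw [List.pairwise_cons] at hb ⊢
    refine ⟨forall_mem_interleave ?_ hb.1, ih ha hb.2⟩
    intro z hz
    rcases List.mem_cons.1 hz with rfl | hz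
    · exact h'
    · exact h'.trans ((List.pairwise_cons.1 ha).1 z hz)
  | case5 e es b bs h h' ih =>
    rw [List.pairwise_cons] at ha hb ⊢
    have heq : e.1 = b.1 := le_antisymm (not_lt.1 h') (not_lt.1 h)
    exact ⟨forall_mem_interleave ha.1 (by simpa only [heq] using hb.1), ih ha.2 hb.2⟩

theorem length_le_interleave (as bs : List (T × S)) :
    as.length ≤ (interleave as bs).length := by
  fun_induction interleave as bs with
  | case1 => simp
  | case2 => simp
  | case3 e es b bs h ih => simpa using ih
  | case4 e es b bs h h' ih => exact ih.trans (by simp)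
  | case5 e es b bs h h' ih => simpa using ih

/-- A strictly increasing bulk has at most one entry at a given timestamp, so an existing separator
stays a single entry with its key. -/
theorem interleave_singleton {e : T × S} {bs : List (T × S)} (hb : Increasing bs)
    (he : ∀ b ∈ bs, b.1 = e.1) : ∃ e', interleave [e] bs = [e'] ∧ e'.1 = e.1 := by
  match bs with
  | [] => exact ⟨e, by simp [interleave], rfl⟩
  | [b] =>
    have := he b (by simp)
    exact ⟨(e.1, e.2 * b.2), by simp [interleave, this], rfl⟩
  | b :: c :: bs =>
    have h1 := he b (by simp)
    have h2 := he c (by simp)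
    have h3 := (List.pairwise_cons.1 hb).1 c (by simp)
    rw [h1, h2] at h3
    exact absurd h3 (lt_irrefl _)

end Interleave

-- Splitting overfull nodes

theorem tightBelow_take (μ h n : ℕ) (a b : S) (es es' : List (T × S)) (cs : List (Node T S)) :
    tightBelow μ h (Node.mk a es (cs.take (n + 1))) = tightBelow μ h (Node.mk b es' cs) := by
  cases h with
  | zero => rfl
  | succ h => cases cs <;> rfl

section Split

variable [Monoid S]

/-- A node is either left whole or its first piece has arity $\mu+1$ and keeps the old first child;
so a split creates no tight node on the left spine. The bounds on lengths are for the growth of the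
root. -/
theorem bulkSplit_spec {μ h : ℕ} (hμ : 2 ≤ μ) {a : S} {es : List (T × S)} {cs : List (Node T S)}
    (hx : (Node.mk a es cs).Balanced μ h) :
    (bulkSplit μ es cs).2.length = (bulkSplit μ es cs).1.length + 1 ∧
      weave (bulkSplit μ es cs).1 (bulkSplit μ es cs).2 = weave es cs ∧
      (μ ≤ es.length + 1 → ∀ n ∈ (bulkSplit μ es cs).2, Good μ h n) ∧
      ((bulkSplit μ es cs = ([], [.mk 1 es cs]) ∧ es.length + 1 ≤ 2 * μ) ∨
        ((bulkSplit μ es cs).1 ≠ [] ∧ (bulkSplit μ es cs).1.length < es.length ∧ 2 * μ ≤ es.length ∧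
          ∃ n ns, (bulkSplit μ es cs).2 = n :: ns ∧ tight μ n = 0 ∧
            tightBelow μ h n = tightBelow μ h (Node.mk a es cs))) := by
  induction hn : es.length using Nat.strong_induction_on generalizing es cs a with
  | _ n ih =>
  by_cases hle : es.length + 1 ≤ 2 * μ
  · have e : bulkSplit μ es cs = ([], [.mk 1 es cs]) := by rw [bulkSplit, if_pos hle]
    rw [e]
    refine ⟨rfl, by simp, fun hμ' z hz => ?_, Or.inl ⟨rfl, by omega⟩⟩
    obtain rfl := List.mem_singleton.1 hz
    exact ⟨by simp; omega, hle, Balanced.congr hx rfl rfl⟩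
  · obtain ⟨s, rest, hs⟩ : ∃ s rest, es.drop μ = s :: rest :=
      ⟨_, _, List.drop_eq_getElem_cons (by omega)⟩
    have hsl := congrArg List.length hs
    simp only [List.length_drop, List.length_cons] at hsl
    have e : bulkSplit μ es cs = (s :: (bulkSplit μ rest (cs.drop (μ + 1))).1,
        .mk 1 (es.take μ) (cs.take (μ + 1)) :: (bulkSplit μ rest (cs.drop (μ + 1))).2) := by
      rw [bulkSplit, if_neg hle]
      split
      · rename_i h'; rw [hs] at h'; cases h'
      · rename_i s' rest' h'
        rw [hs] at h'
        cases h'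
        rfl
    obtain ⟨b1, b2, b3⟩ := Balanced.split hx hs 1 1
    obtain ⟨i1, i2, i3, i4⟩ := ih rest.length (by omega) b2 rfl
    rw [e]
    refine ⟨by simp [i1], ?_, fun _ z hz => ?_, Or.inr ⟨by simp, ?_, by omega, _, _, rfl, ?_, ?_⟩⟩
    · simp [i2, b3]
    · rcases List.mem_cons.1 hz with rfl | hz
      · exact ⟨by simp; omega, by simp; omega, b1⟩
      -- A node is cut only when it has at least $2\mu$ entries; after removing $\mu$ of them and
      -- the separator, at least $\mu-1$ remain.
      · exact i3 (by omega) z hz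
    · rcases i4 with ⟨i4, -⟩ | ⟨-, i4, -⟩
      · simp [i4]; omega
      · simp; omega
    · simp [tight]; omega
    · exact tightBelow_take _ _ _ _ _ _ _ _

end Split

-- Inserting a bulk into a subtree

section Insert

variable [LinearOrder T] [Monoid S]

/-- What `insertNode` does to a node of height `h` before the node itself is split. -/
def InsertsAt (μ h : ℕ) (x : Node T S) (B : List (T × S)) : Prop :=
  ∃ es cs, insertNode μ x B = bulkSplit μ es cs ∧ (Node.mk 1 es cs).Balanced μ h ∧
    x.entries.length ≤ es.length ∧ Increasing (weave es cs) ∧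
    (∀ P : T → Prop, (∀ e ∈ x.toList, P e.1) → (∀ b ∈ B, P b.1) → ∀ e ∈ weave es cs, P e.1) ∧
    tightBelow μ h (Node.mk 1 es cs) ≤ tightBelow μ h x

/-- The nodes `r.2`, separated by the entries `r.1`, replace subtrees with contents `l` after the
insertion of `B`; `τ` bounds the tight nodes on their left spine. -/
structure Inserted (μ h : ℕ) (l B : List (T × S)) (τ : ℕ)
    (r : List (T × S) × List (Node T S)) : Prop where
  length : r.2.length = r.1.length + 1
  good : ∀ n ∈ r.2, Good μ h n
  increasing : Increasing (weave r.1 r.2)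
  keys : ∀ P : T → Prop, (∀ e ∈ l, P e.1) → (∀ b ∈ B, P b.1) → ∀ e ∈ weave r.1 r.2, P e.1
  tight : ∃ n ns, r.2 = n :: ns ∧ tight μ n + tightBelow μ h n ≤ τ

/-- The state before the split is kept apart because the root may have fewer than $\mu$ children.
For other nodes, entries are only gained, so an unsplit result is tight only if the node was tight
before. -/
theorem InsertsAt.inserted {μ h : ℕ} (hμ : 2 ≤ μ) {x : Node T S} {B : List (T × S)}
    (hx : μ ≤ x.arity) (H : InsertsAt μ h x B) :
    Inserted μ h x.toList B (FiBA.tight μ x + tightBelow μ h x) (insertNode μ x B) := by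
  obtain ⟨es, cs, h1, h2, h3, h4, h5, h6⟩ := H
  obtain ⟨i1, i2, i3, i4⟩ := bulkSplit_spec hμ h2
  rw [h1]
  rw [Node.arity] at hx
  refine ⟨i1, i3 (by omega), by rwa [i2], by rwa [i2], ?_⟩
  rcases i4 with ⟨i4, -⟩ | ⟨-, -, -, n, ns, j1, j2, j3⟩
  · refine ⟨_, _, by rw [i4], Nat.add_le_add ?_ h6⟩
    unfold FiBA.tight
    split_ifs with ha hb hb
    · exact le_rfl
    · exfalso
      rw [Node.arity] at hb
      simp only [Node.arity_mk] at ha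
      omega
    · omega
    · exact le_rfl
  · exact ⟨n, ns, j1, by omega⟩

theorem insertChildren_spec {μ h : ℕ} (hμ : 2 ≤ μ)
    (H : ∀ (x : Node T S) (B : List (T × S)), x.Balanced μ h → Increasing x.toList →
      Increasing B → InsertsAt μ h x B)
    (es : List (T × S)) (c : Node T S) (cs : List (Node T S)) (B : List (T × S))
    (hlen : cs.length = es.length) (hg : ∀ d ∈ c :: cs, Good μ h d)
    (hinc : Increasing (weave es (c :: cs))) (hB : Increasing B) :
    Inserted μ h (weave es (c :: cs)) B (tight μ c + tightBelow μ h c)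
        (insertChildren μ (c :: cs) es B) ∧
      es.length ≤ (insertChildren μ (c :: cs) es B).1.length := by
  have hc := hg c (by simp)
  induction es generalizing c cs B with
  | nil =>
    obtain rfl : cs = [] := by simpa using hlen
    have e : insertChildren μ [c] [] B = insertNode μ c B := by
      simp [insertChildren]
    rw [e]
    simp only [weave_cons, weaveE_nil_right, List.append_nil] at hinc ⊢
    exact ⟨(H c B hc.2.2 hinc hB).inserted hμ hc.1, by simp⟩
  | cons e es ih =>
    match cs with
    | [] => simp at hlen
    | d :: cs =>
      simp only [weave_cons (es := e :: es), weaveE_cons] at hinc ⊢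
      obtain ⟨inc1, inc2, inc3⟩ := List.pairwise_append.1 hinc
      rw [List.pairwise_cons] at inc2
      have L := (H c (B.filter fun b => b.1 < e.1) hc.2.2 inc1 (hB.filter _)).inserted hμ hc.1
      obtain ⟨R, Rlen⟩ := ih d cs (B.filter fun b => e.1 < b.1) (by simpa using hlen)
        (fun z hz => hg z (List.mem_cons_of_mem _ hz)) inc2.2 (hB.filter _) (hg d (by simp))
      obtain ⟨e', he', hee⟩ := interleave_singleton (e := e) (hB.filter fun b => b.1 = e.1)
        (by intro b hb; simpa using (List.mem_filter.1 hb).2)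
      have eq : insertChildren μ (c :: d :: cs) (e :: es) B =
          ((insertNode μ c (B.filter fun b => b.1 < e.1)).1 ++ e' ::
            (insertChildren μ (d :: cs) es (B.filter fun b => e.1 < b.1)).1,
            (insertNode μ c (B.filter fun b => b.1 < e.1)).2 ++
            (insertChildren μ (d :: cs) es (B.filter fun b => e.1 < b.1)).2) := by
        rw [insertChildren, he']
        simp
      rw [eq]
      have hw := weave_append (cs₁ := (insertNode μ c (B.filter fun b => b.1 < e.1)).2) e'
        (insertChildren μ (d :: cs) es (B.filter fun b => e.1 < b.1)).1
        (insertChildren μ (d :: cs) es (B.filter fun b => e.1 < b.1)).2 L.length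
      have hl : ∀ z ∈ weave (insertNode μ c (B.filter fun b => b.1 < e.1)).1
          (insertNode μ c (B.filter fun b => b.1 < e.1)).2, z.1 < e'.1 :=
        -- Quantifying over predicates on timestamps lets the same field give an upper bound for the
        -- left part and a lower bound for the right part.
        L.keys (· < e'.1) (fun z hz => by rw [hee]; exact inc3 z hz e (by simp))
          (fun z hz => by rw [hee]; simpa using (List.mem_filter.1 hz).2)
      have hr : ∀ z ∈ weave (insertChildren μ (d :: cs) es (B.filter fun b => e.1 < b.1)).1
          (insertChildren μ (d :: cs) es (B.filter fun b => e.1 < b.1)).2, e'.1 < z.1 :=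
        R.keys (e'.1 < ·) (fun z hz => by rw [hee]; exact inc2.1 z hz)
          (fun z hz => by rw [hee]; simpa using (List.mem_filter.1 hz).2)
      refine ⟨⟨?_, ?_, ?_, ?_, ?_⟩, ?_⟩
      · simp [L.length, R.length]; omega
      · intro z hz
        rcases List.mem_append.1 hz with hz | hz
        · exact L.good z hz
        · exact R.good z hz
      · simp only [hw]
        refine List.pairwise_append.2 ⟨L.increasing, List.pairwise_cons.2 ⟨hr, R.increasing⟩, ?_⟩
        intro y hy z hz
        rcases List.mem_cons.1 hz with rfl | hz
        · exact hl y hy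
        · exact (hl y hy).trans (hr z hz)
      · intro P hP hPB z hz
        simp only [hw] at hz
        rcases List.mem_append.1 hz with hz | hz
        · exact L.keys P (fun y hy => hP y (List.mem_append_left _ hy))
            (fun y hy => hPB y (List.mem_filter.1 hy).1) z hz
        · rcases List.mem_cons.1 hz with rfl | hz
          · rw [hee]; exact hP e (by simp)
          · exact R.keys P (fun y hy => hP y (List.mem_append_right _ (List.mem_cons_of_mem _ hy)))
              (fun y hy => hPB y (List.mem_filter.1 hy).1) z hz
      · obtain ⟨n, ns, h1, h2⟩ := L.tight
        exact ⟨n, _, by rw [h1]; rfl, h2⟩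
      · simp; omega

theorem insertNode_spec {μ : ℕ} (hμ : 2 ≤ μ) (h : ℕ) (x : Node T S) (B : List (T × S))
    (hx : x.Balanced μ h) (hinc : Increasing x.toList) (hB : Increasing B) :
    InsertsAt μ h x B := by
  induction h generalizing x B with
  | zero =>
    obtain ⟨a, es, cs⟩ := x
    obtain rfl : cs = [] := balanced_zero.1 hx
    simp only [Node.toList_mk, weave_nil_right] at hinc
    refine ⟨interleave es B, [], by simp [insertNode], balanced_zero.2 rfl,
      length_le_interleave es B, ?_, ?_, le_rfl⟩
    · simpa using increasing_interleave hinc hB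
    · intro P h1 h2
      simp only [Node.toList_mk, weave_nil_right] at h1 ⊢
      exact forall_mem_interleave h1 h2
  | succ h ih =>
    obtain ⟨a, es, cs⟩ := x
    have hb := balanced_succ.1 hx
    simp only [Node.entries_mk, Node.children_mk] at hb
    match cs with
    | [] => simp at hb
    | c :: cs =>
      rw [Node.toList_mk] at hinc
      obtain ⟨i1, i2⟩ := insertChildren_spec hμ ih es c cs B (by simpa using hb.1) hb.2 hinc hB
      obtain ⟨n, ns, j1, j2⟩ := i1.tight
      refine ⟨_, _, by rw [insertNode], balanced_succ.2 ⟨i1.length, i1.good⟩, i2, i1.increasing,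
        ?_, ?_⟩
      · rw [Node.toList_mk]
        exact i1.keys
      · rw [tightBelow_cons μ h (c := n) (cs := ns) (by simpa using j1),
          tightBelow_cons μ h (c := c) (cs := cs) rfl]
        exact j2

end Insert

-- Growing the tree at the top

section Grow

variable [Monoid S]

/-- Each actual split promotes strictly fewer entries than it received, so fuel one above the number
of entries is enough. A level enters the left spine only as the first piece of a split, which is not
tight. -/
theorem growRoot_spec {μ : ℕ} (hμ : 2 ≤ μ) {k h : ℕ} {es : List (T × S)} {c : Node T S}
    {cs : List (Node T S)} (hk : es.length + 1 ≤ k) (hne : es ≠ []) (hlen : cs.length = es.length)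
    (hg : ∀ d ∈ c :: cs, Good μ h d) :
    ∃ h', RootTree μ h' (growRoot μ k es (c :: cs)) ∧
      (growRoot μ k es (c :: cs)).toList = weave es (c :: cs) ∧
      tightBelow μ h' (growRoot μ k es (c :: cs)) ≤ tight μ c + tightBelow μ h c := by
  induction k generalizing h es c cs with
  | zero => omega
  | succ k ih =>
    match es, cs with
    | [], _ => exact absurd rfl hne
    | _ :: _, [] => simp at hlen
    | e :: es, d :: cs =>
      have hb : (Node.mk (1 : S) (e :: es) (c :: d :: cs)).Balanced μ (h + 1) :=
        balanced_succ.2 ⟨by simpa using hlen, hg⟩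
      have eq : growRoot μ (k + 1) (e :: es) (c :: d :: cs) =
          growRoot μ k (bulkSplit μ (e :: es) (c :: d :: cs)).1
            (bulkSplit μ (e :: es) (c :: d :: cs)).2 := by
        rw [growRoot]
        simp
      rw [eq]
      obtain ⟨i1, i2, i3, i4⟩ := bulkSplit_spec hμ hb
      have htb := tightBelow_cons μ h (x := Node.mk (1 : S) (e :: es) (c :: d :: cs)) (c := c)
        (cs := d :: cs) rfl
      rcases i4 with ⟨i4, i5⟩ | ⟨j0, j1, j2, n, ns, j3, j4, j5⟩
      · rw [i4]
        match k with
        | 0 => simp at hk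
        | k + 1 =>
          have e1 : growRoot μ (k + 1) ([] : List (T × S))
            [Node.mk (1 : S) (e :: es) (c :: d :: cs)] =
            Node.mk (1 : S) (e :: es) (c :: d :: cs) := rfl
          rw [e1]
          exact ⟨h + 1, ⟨hb, i5, Or.inl (by simp)⟩, by simp, htb.le⟩
      · have i3' := i3 (by omega)
        rw [j3] at i1 i2 i3' ⊢
        obtain ⟨h', q1, q2, q3⟩ := ih (h := h + 1) (es := (bulkSplit μ (e :: es) (c :: d :: cs)).1)
          (c := n) (cs := ns) (by omega) j0 (by simpa using i1) i3'
        exact ⟨h', q1, q2.trans i2, by omega⟩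

theorem upAll_eq (x : Node T S) : ∃ a, x.upAll = .mk a x.entries (x.children.map Node.upAll) := by
  obtain ⟨a, es, cs⟩ := x
  rw [Node.upAll]
  exact ⟨_, rfl⟩

theorem arity_upAll (x : Node T S) : x.upAll.arity = x.arity := by
  obtain ⟨a, h⟩ := upAll_eq x
  rw [h]; rfl

theorem balanced_upAll {μ h : ℕ} {x : Node T S} (hx : x.Balanced μ h) :
    x.upAll.Balanced μ h ∧ x.upAll.toList = x.toList ∧
      tightBelow μ h x.upAll = tightBelow μ h x := by
  induction h generalizing x with
  | zero =>
    rw [balanced_zero] at hx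
    obtain ⟨a, e⟩ := upAll_eq x
    rw [e, hx]
    refine ⟨balanced_zero.2 rfl, ?_, rfl⟩
    rw [Node.toList_eq x, hx]
    simp
  | succ h ih =>
    rw [balanced_succ] at hx
    obtain ⟨a, e⟩ := upAll_eq x
    refine ⟨balanced_succ.2 ⟨by simp [e, hx.1], ?_⟩, ?_, ?_⟩
    · intro c hc
      simp only [e, Node.children_mk, List.mem_map] at hc
      obtain ⟨d, hd, rfl⟩ := hc
      have hdg := hx.2 d hd
      exact ⟨by rw [arity_upAll]; exact hdg.1, by rw [arity_upAll]; exact hdg.2.1,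
        (ih hdg.2.2).1⟩
    · rw [e, Node.toList_eq x, Node.toList_mk]
      unfold weave
      congr 2
      rw [List.map_map]
      exact List.map_congr_left fun d hd => (ih (hx.2 d hd).2.2).2.1
    · match hc : x.children with
      | [] => rw [hc] at hx; simp at hx
      | c :: cs =>
        rw [tightBelow_cons μ h hc, tightBelow_cons μ h (c := c.upAll) (cs := cs.map Node.upAll)
          (by simp [e, hc]), (ih (hx.2 c (by simp [hc])).2.2).2.2]
        simp [tight, arity_upAll]

end Grow

/-- If the old root is not split, the spine below it carries at most the old potential; if it is
split, the levels added on top contribute nothing. -/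
theorem bulkInsert_spec [LinearOrder T] [Monoid S] {μ : ℕ} (hμ : 2 ≤ μ) {f : FiBA T S}
    (hf : Shape μ f) (hinc : Increasing f.window) {B : List (T × S)} (hB : Increasing B) :
    Shape μ (bulkInsert μ f B) ∧ Increasing (bulkInsert μ f B).window ∧
      tightCount μ (bulkInsert μ f B).left ≤ tightCount μ f.left := by
  have hroot := (shape_iff.1 hf).2
  obtain ⟨es, cs, h1, h2, h3, h4, -, h6⟩ := insertNode_spec hμ _ _ B hroot.balanced hinc hB
  rw [tightBelow_toTree] at h6
  obtain ⟨i1, i2, i3, i4⟩ := bulkSplit_spec hμ h2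
  suffices H : ∃ h' x, RootTree μ h' x ∧ x.toList = weave es cs ∧
      tightBelow μ h' x ≤ tightCount μ f.left ∧
      bulkInsert μ f B = (makeRoot x.upAll).val by
    obtain ⟨h', x, q1, q2, q3, q4⟩ := H
    obtain ⟨u1, u2, u3⟩ := balanced_upAll q1.balanced
    obtain ⟨m1, m2, -, m4, -⟩ := makeRoot_spec hμ (x := x.upAll)
      ⟨u1, by rw [arity_upAll]; exact q1.arity_le, by rw [arity_upAll]; exact q1.two_le⟩
    rw [q4]
    exact ⟨m1, by rw [m2, u2, q2]; exact h4, by rw [m4, u3]; exact q3⟩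
  have eB : bulkInsert μ f B = (makeRoot (growRoot μ ((bulkSplit μ es cs).1.length + 2)
      (bulkSplit μ es cs).1 (bulkSplit μ es cs).2).upAll).val := by
    rw [bulkInsert, h1]
  rcases i4 with ⟨i4, i5⟩ | ⟨j0, j1, j2, n, ns, j3, j4, j5⟩
  · refine ⟨_, _, ⟨h2, i5, ?_⟩, by simp, h6, ?_⟩
    · rcases hroot.two_le with h | h
      · left
        rw [Node.arity] at h
        simp only [Node.arity_mk]
        omega
      · exact Or.inr h
    · rw [eB, i4]
      rfl
  · have i3' := i3 (by omega)
    rw [j3] at i1 i2 i3' eB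
    obtain ⟨h', q1, q2, q3⟩ := growRoot_spec hμ (k := (bulkSplit μ es cs).1.length + 2)
      (by omega) j0 (by simpa using i1) i3'
    exact ⟨h', _, q1, q2.trans i2, by omega, eB⟩

/-! ### Sequences of operations -/

/-- Taking logarithms and using $1/2\le\log 2\le 1$ gives $k\le 2+2\log(1+m)$. -/
theorem succ_le_four_mul_log {k m : ℕ} (h : 2 ^ k ≤ 2 * (m + 1)) :
    (k : ℝ) + 1 ≤ 4 * (1 + Real.log (1 + m)) := by
  have h1 : ((2 : ℝ) ^ k) ≤ 2 * (1 + m) := by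
    have : ((2 ^ k : ℕ) : ℝ) ≤ ((2 * (m + 1) : ℕ) : ℝ) := by exact_mod_cast h
    push_cast at this
    linarith
  have hm : (0 : ℝ) < 1 + m := by positivity
  have h2 := Real.log_le_log (by positivity) h1
  rw [Real.log_pow, Real.log_mul (by norm_num) hm.ne'] at h2
  have h3 : (1 / 2 : ℝ) ≤ Real.log 2 := by linarith [Real.log_two_gt_d9]
  have h4 : Real.log 2 ≤ 1 := by linarith [Real.log_two_lt_d9]
  have h5 : (k : ℝ) * (1 / 2) ≤ k * Real.log 2 :=
    mul_le_mul_of_nonneg_left h3 (Nat.cast_nonneg k)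
  have h6 : 0 ≤ Real.log (1 + m) := Real.log_nonneg (by simp)
  linarith

theorem shape_empty [Monoid S] {μ : ℕ} (hμ : 2 ≤ μ) : Shape μ (empty : FiBA T S) :=
  ⟨rfl, trivial, trivial, by simp [empty]; omega, Or.inl ⟨rfl, rfl⟩⟩

variable [LinearOrder T] [Monoid S]

theorem Valid.shape {μ : ℕ} {f : FiBA T S} (hf : f.Valid μ) : Shape μ f :=
  shape_iff.2 ⟨hf.spines, hf.balanced, hf.root_max, by
    rcases hf.root_min with h | h
    · exact Or.inl h
    · exact Or.inr (by simp [h])⟩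

theorem bulkEvict_amortized {μ : ℕ} (hμ : 2 ≤ μ) {f : FiBA T S} (hf : Shape μ f)
    (hinc : Increasing f.window) (t : T) :
    ((bulkEvict μ f t).time : ℝ) + 50 * μ * tightCount μ (bulkEvict μ f t).val.left ≤
      50 * μ * tightCount μ f.left + 1000 * μ * (1 + Real.log (1 + evictCount f t)) := by
  obtain ⟨-, -, k, -, h2, h3⟩ := bulkEvict_spec hμ hf hinc t
  have h4 := succ_le_four_mul_log h2
  have h5 : ((bulkEvict μ f t).time : ℝ) + 50 * μ * tightCount μ (bulkEvict μ f t).val.left ≤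
      50 * μ * tightCount μ f.left + 200 * μ * (k + 1) := by exact_mod_cast h3
  have h6 := mul_le_mul_of_nonneg_left h4 (Nat.cast_nonneg (α := ℝ) μ)
  have h7 : 0 ≤ (μ : ℝ) * (1 + Real.log (1 + evictCount f t)) :=
    mul_nonneg (Nat.cast_nonneg _) (by
      have : 0 ≤ Real.log (1 + (evictCount f t : ℝ)) := Real.log_nonneg (by simp)
      linarith)
  linarith

/-- Both the charged level and the initial potential are bounded by the height: $200\mu+50\mu$ per
level, times the 4 from the logarithm, gives exactly $1000\mu$. -/
theorem bulkEvict_worst_case {μ : ℕ} (hμ : 2 ≤ μ) {f : FiBA T S} (hf : Shape μ f)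
    (hinc : Increasing f.window) (t : T) :
    ((bulkEvict μ f t).time : ℝ) ≤ 1000 * μ * (1 + Real.log (1 + size f)) := by
  obtain ⟨-, -, k, h1, -, h3⟩ := bulkEvict_spec hμ hf hinc t
  have hsize : 2 ^ f.left.length ≤ 2 * (size f + 1) := by
    have := hf.length_window hμ
    rw [size, hf.window_eq, List.length_append, List.length_append]
    omega
  have h4 := succ_le_four_mul_log hsize
  have h5 := tightCount_le_length μ f.left
  have h6 : (bulkEvict μ f t).time ≤ 250 * μ * (f.left.length + 1) := by
    have e1 := Nat.mul_le_mul_left (50 * μ) h5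
    have e2 := Nat.mul_le_mul_left (200 * μ) h1
    have e3 := Nat.zero_le (50 * μ * tightCount μ (bulkEvict μ f t).val.left)
    linarith
  have h7 : ((bulkEvict μ f t).time : ℝ) ≤ 250 * μ * (f.left.length + 1) := by exact_mod_cast h6
  have h8 := mul_le_mul_of_nonneg_left h4 (Nat.cast_nonneg (α := ℝ) μ)
  linarith

/-- Stated for an arbitrary start with its potential on the right-hand side, so that the costs
telescope in the induction over the operations. -/
theorem evictions_spec {μ : ℕ} (hμ : 2 ≤ μ) {f : FiBA T S} (hf : Shape μ f)
    (hinc : Increasing f.window) {ops : List (Op T S)} (hops : ∀ op ∈ ops, op.WellFormed) :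
    (∀ r ∈ evictions μ f ops, (r.time : ℝ) ≤ 1000 * μ * (1 + Real.log (1 + r.n))) ∧
      ((evictions μ f ops).map fun r => (r.time : ℝ)).sum ≤ 50 * μ * tightCount μ f.left +
        1000 * μ * ((evictions μ f ops).map fun r => 1 + Real.log (1 + r.m)).sum := by
  induction ops generalizing f with
  | nil =>
    simp only [evictions, List.not_mem_nil, false_imp_iff, implies_true, List.map_nil,
      List.sum_nil, mul_zero, add_zero, true_and]
    positivity
  | cons op ops ih =>
    have hops' : ∀ op ∈ ops, op.WellFormed := fun o ho => hops o (List.mem_cons_of_mem _ ho)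
    cases op with
    | query => exact ih hf hinc hops'
    | bulkInsert B =>
      obtain ⟨h1, h2, h3⟩ := bulkInsert_spec hμ hf hinc (B := B)
        (hops (.bulkInsert B) List.mem_cons_self)
      obtain ⟨i1, i2⟩ := ih h1 h2 hops'
      refine ⟨i1, i2.trans ?_⟩
      have : (tightCount μ (bulkInsert μ f B).left : ℝ) ≤ tightCount μ f.left := by
        exact_mod_cast h3
      have := mul_le_mul_of_nonneg_left this (Nat.cast_nonneg (α := ℝ) μ)
      simp only [evictions]
      linarith
    | bulkEvict t =>
      obtain ⟨h1, h2, -⟩ := bulkEvict_spec hμ hf hinc t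
      obtain ⟨i1, i2⟩ := ih h1 (hinc.sublist h2) hops'
      have ha := bulkEvict_amortized hμ hf hinc t
      have hw := bulkEvict_worst_case hμ hf hinc t
      simp only [evictions, List.map_cons, List.sum_cons, List.mem_cons, forall_eq_or_imp]
      exact ⟨⟨hw, i1⟩, by linarith⟩

end FiBA

-- The theorem

theorem mainTheorem1 (μ : ℕ) (hμ : 2 ≤ μ) :
    ∃ C : ℝ, 0 < C ∧
      ∀ (T : Type u) (S : Type v) [LinearOrder T] [Monoid S],
        -- worst case, for every structure that satisfies the invariants
        (∀ (f : FiBA T S) (t : T), f.Valid μ →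
          ((FiBA.bulkEvict μ f t).time : ℝ) ≤ C * (1 + Real.log (1 + FiBA.size f))) ∧
        -- any sequence of operations from the empty window
        (∀ ops : List (FiBA.Op T S), (∀ op ∈ ops, op.WellFormed) →
          -- worst case
          (∀ r ∈ FiBA.evictions μ FiBA.empty ops,
            (r.time : ℝ) ≤ C * (1 + Real.log (1 + r.n))) ∧
          -- amortized
          ((FiBA.evictions μ FiBA.empty ops).map fun r => (r.time : ℝ)).sum ≤
            C * ((FiBA.evictions μ FiBA.empty ops).map fun r => 1 + Real.log (1 + r.m)).sum) := by
  refine ⟨1000 * μ, by positivity, fun T S _ _ => ⟨fun f t hf =>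
    FiBA.bulkEvict_worst_case hμ hf.shape hf.order t, fun ops hops => ?_⟩⟩
  have hw : FiBA.Increasing (FiBA.empty : FiBA T S).window := by
    rw [(FiBA.shape_empty hμ).window_eq]
    simp [FiBA.Increasing, FiBA.empty, FiBA.tailList]
  obtain ⟨h1, h2⟩ := FiBA.evictions_spec hμ (FiBA.shape_empty hμ) hw hops
  exact ⟨h1, by simpa [FiBA.empty] using h2⟩
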